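/- Let $\Gamma\subset GL_3(\mathbb C)$ be a subgroup, and let $\Gamma_V$ be the set of pairs $(\alpha,\beta)\in\mathbb C^2$ with $\beta+\bar\beta=\alpha\bar\alpha$ and $\begin{pmatrix}1&\alpha&\beta\\0&1&\bar\alpha\\0&0&1\end{pmatrix}\in\Gamma$. Assume that $\mathcal R=\{\alpha : \exists\beta,\ (\alpha,\beta)\in\Gamma_V\}$ is a lattice in $\mathbb C$, and let $\beta_0$ be the element of least positive imaginary part among the $\beta$ with $(0,\beta)\in\Gamma_V$ and $\operatorname{Im}\beta>0$. (For $F\subset\mathbb C$ an imaginary quadratic field and $\Gamma$ a congruence subgroup of the group $SU(2,1)$ of the Hermitian form $-x\bar t+y\bar y-t\bar x$ over $F$, these assumptions hold and $\mathcal R$ is a CM lattice in $F$.) Let $\mathcal E=\mathbb C/\overline{\mathcal R}$, $\mathcal E'=\mathbb C/\mathcal R$, and $\mathbf W=\mathcal R\backslash(\mathbb C\times\mathbb C)$, where $\alpha\in\mathcal R$ acts by $(z,z')\mapsto(z+\bar\alpha,\,z'-\alpha)$. Then the complex manifold $\mathbf W$ is Stein. Moreover, for an integer $r\ge 0$ and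 a unitary character $\psi$ of $\mathcal R$, let $f$, $f'$ be entire functions (theta functions on $\mathcal E$ and $\mathcal E'$) such that for all $(\alpha,\beta)\in\Gamma_V$ $$f(z+\bar\alpha)=\psi(\alpha)f(z)\exp\Bigl(\tfrac{2\pi i r}{\beta_0}(\alpha z+\beta)\Bigr),\qquad f'(z'-\alpha)=\psi(\alpha)^{-1}f'(z')\exp\Bigl(\tfrac{2\pi i r}{\beta_0}(-\bar\alpha z'+\bar\beta)\Bigr).$$ Then $g(z,z')=f(z)f'(z')\exp(2\pi i r zz'/\beta_0)$ descends to a holomorphic function on $\mathbf W$. For all sufficiently large $r$: (i) the functions $g$ with $\psi=1$ separate any two points of $\mathbf W$ whose images in $\mathcal E\times\mathcal E'$ are distinct; (ii) the functions $g$, with $\psi$ arbitrary, separate any two distinct points of $\mathbf W$; (iii) for every sequence in $\mathbf W$ without accumulation point there is a function $g$ with $\psi=1$ that is unbounded on that sequence. -/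

import Mathlib

open Complex Filter Topology Manifold
open scoped ContDiff ComplexConjugate

noncomputable section

/-- A complex manifold `M` modelled on the finite-dimensional complex space `E` is a *Stein manifold*
if it is Hausdorff with countable topology, holomorphically convex, holomorphically separable, and
every point has local coordinates given by globally defined holomorphic functions. -/
structure IsSteinManifold (E : Type*) [NormedAddCommGroup E] [NormedSpace ℂ E]
    [FiniteDimensional ℂ E] (M : Type*) [TopologicalSpace M] [ChartedSpace E M] : Prop where
  isManifold : IsManifold 𝓘(ℂ, E) ω M
  t2Space : T2Space M
  secondCountable : SecondCountableTopology M
  holomorphicallyConvex : ∀ K : Set M, IsCompact K →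
    IsCompact {x : M | ∀ f : M → ℂ, MDifferentiable 𝓘(ℂ, E) 𝓘(ℂ, ℂ) f →
      ∀ C : ℝ, (∀ y ∈ K, ‖f y‖ ≤ C) → ‖f x‖ ≤ C}
  separatesPoints : ∀ x y : M, x ≠ y →
    ∃ f : M → ℂ, MDifferentiable 𝓘(ℂ, E) 𝓘(ℂ, ℂ) f ∧ f x ≠ f y
  localCoordinates : ∀ x : M, ∃ F : M → E, MDifferentiable 𝓘(ℂ, E) 𝓘(ℂ, E) F ∧
    Function.Bijective (mfderiv 𝓘(ℂ, E) 𝓘(ℂ, E) F x)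

/-- The group of translations of `ℂ × ℂ` by the vectors `(conj α, -α)`, `α ∈ R`. -/
def twistedLattice (R : AddSubgroup ℂ) : AddSubgroup (ℂ × ℂ) :=
  R.map ((starRingEnd ℂ).toAddMonoidHom.prod (-AddMonoidHom.id ℂ))

theorem mem_twistedLattice {R : AddSubgroup ℂ} {p : ℂ × ℂ} :
    p ∈ twistedLattice R ↔ ∃ α ∈ R, (conj α, -α) = p := by
  simp [twistedLattice]

instance twistedLattice_discrete (R : AddSubgroup ℂ) [DiscreteTopology R] :
    DiscreteTopology (twistedLattice R) := by
  let g : twistedLattice R → R := fun p => ⟨-p.1.2, by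
    obtain ⟨α, hα, h⟩ := mem_twistedLattice.1 p.2
    rw [← h]; simpa using hα⟩
  have hg : Continuous g := by
    apply Continuous.subtype_mk
    fun_prop
  refine DiscreteTopology.of_continuous_injective hg ?_
  rintro ⟨p, hp⟩ ⟨q, hq⟩ h
  obtain ⟨α, hα, rfl⟩ := mem_twistedLattice.1 hp
  obtain ⟨β, hβ, rfl⟩ := mem_twistedLattice.1 hq
  have : α = β := by simpa [g] using h
  subst this
  rfl

instance twistedLattice_properlyDiscontinuous (R : AddSubgroup ℂ) [DiscreteTopology R] :
    ProperlyDiscontinuousVAdd (twistedLattice R) (ℂ × ℂ) :=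
  AddSubgroup.properlyDiscontinuousVAdd_of_tendsto_cofinite _
    (AddSubgroup.tendsto_coe_cofinite_of_discrete (twistedLattice R)
      (isDiscrete_iff_discreteTopology.2 (twistedLattice_discrete R)))

/-- `𝐖 = R \ (ℂ × ℂ)`, where `α ∈ R` acts by `(z, z') ↦ (z + conj α, z' - α)`. -/
def QuotW (R : AddSubgroup ℂ) : Type :=
  AddAction.orbitRel.Quotient (twistedLattice R) (ℂ × ℂ)

instance QuotW.instTopologicalSpace (R : AddSubgroup ℂ) : TopologicalSpace (QuotW R) :=
  inferInstanceAs (TopologicalSpace (AddAction.orbitRel.Quotient (twistedLattice R) (ℂ × ℂ)))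

/-- The complex structure of `𝐖`: the charts are the local inverses of the covering map from
`ℂ × ℂ` to `𝐖`. -/
instance QuotW.instChartedSpace (R : AddSubgroup ℂ) [DiscreteTopology R] : ChartedSpace (ℂ × ℂ) (QuotW R) :=
  @AddAction.instChartedSpaceQuotient (ℂ × ℂ) _ (twistedLattice R) _ _ _ _ _ _ _ (ℂ × ℂ) _
    (chartedSpaceSelf (ℂ × ℂ))

/-- The class in `𝐖` of the point `(z, z')`. -/
def QuotW.mk (R : AddSubgroup ℂ) (z z' : ℂ) : QuotW R :=
  Quotient.mk (AddAction.orbitRel (twistedLattice R) (ℂ × ℂ)) (z, z')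

/-- The matrix with rows `(1, α, β)`, `(0, 1, conj α)`, `(0, 0, 1)` satisfies `β + conj β = α conj α`
and belongs to `Γ`. The matrices of this shape that satisfy the first condition form the unipotent
radical of a Borel subgroup of the special unitary group of the Hermitian form
`-x conj t + y conj y - t conj x`. -/
def IsUnipotentIn (Γ : Subgroup (GL (Fin 3) ℂ)) (α β : ℂ) : Prop :=
  β + conj β = α * conj α ∧
    ∃ γ ∈ Γ, (γ : Matrix (Fin 3) (Fin 3) ℂ) = !![1, α, β; 0, 1, conj α; 0, 0, 1]

/-- `β₀` is the purely imaginary number of least positive imaginary part among those for which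
the matrix with rows `(1, 0, β₀)`, `(0, 1, 0)`, `(0, 0, 1)` is in `Γ`. -/
def IsLeastCentral (Γ : Subgroup (GL (Fin 3) ℂ)) (β₀ : ℂ) : Prop :=
  IsUnipotentIn Γ 0 β₀ ∧ 0 < β₀.im ∧ ∀ β : ℂ, IsUnipotentIn Γ 0 β → 0 < β.im → β₀.im ≤ β.im

/-- Theta functions of level `r` and character `ψ` for the elliptic curve
`ℂ / {conj α | α ∈ R}`. -/
def IsTheta (Γ : Subgroup (GL (Fin 3) ℂ)) (R : AddSubgroup ℂ) (β₀ : ℂ) (r : ℕ)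
    (ψ : AddChar R Circle) (f : ℂ → ℂ) : Prop :=
  Differentiable ℂ f ∧ ∀ (α : R) (β : ℂ), IsUnipotentIn Γ α β → ∀ z : ℂ,
    f (z + conj (α : ℂ)) =
      ψ α * f z * exp (2 * Real.pi * I * r / β₀ * (α * z + β))

/-- Theta functions of level `r` and character `ψ` for the conjugate elliptic curve `ℂ / R`. -/
def IsConjTheta (Γ : Subgroup (GL (Fin 3) ℂ)) (R : AddSubgroup ℂ) (β₀ : ℂ) (r : ℕ)
    (ψ : AddChar R Circle) (f' : ℂ → ℂ) : Prop :=
  Differentiable ℂ f' ∧ ∀ (α : R) (β : ℂ), IsUnipotentIn Γ α β → ∀ z' : ℂ,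
    f' (z' - α) =
      ψ α * f' z' * exp (2 * Real.pi * I * r / β₀ * (-conj (α : ℂ) * z' + conj β))

/-- `G` is the function on `𝐖` induced by `f(z) f'(z') exp(2πi r z z' / β₀)`, where `f` and `f'` are
theta functions of level `r` with the inverse characters `ψ` and `ψ⁻¹`. -/
def IsThetaProduct (Γ : Subgroup (GL (Fin 3) ℂ)) (R : AddSubgroup ℂ) (β₀ : ℂ) (r : ℕ)
    (ψ : AddChar R Circle) (G : QuotW R → ℂ) : Prop :=
  ∃ f f' : ℂ → ℂ, IsTheta Γ R β₀ r ψ f ∧ IsConjTheta Γ R β₀ r ψ⁻¹ f' ∧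
    ∀ z z' : ℂ, G (QuotW.mk R z z') =
      f z * f' z' * exp (2 * Real.pi * I * r / β₀ * (z * z'))

end

/-! For a ℤ-basis `α₁, α₂` of `R` the vectors `(conj αᵢ, -αᵢ)` are a complex basis of ℂ². Hence 𝐖 is
(ℂ/ℤ)², which exponentials identify with (ℂˣ)², and the Stein conditions are checked with Laurent
monomials (`isSteinManifold_quotW`).

A product `f f' exp(2πi r z z'/β₀)` descends because the characters cancel and the exponents of the
three factors change by a multiple of `β + conj β - α conj α = 0` (`theta_mul_conjTheta_invariant`).

Theta functions exist in abundance: their factors form a cocycle on a Heisenberg group whose centre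
`ℤ β₀` acts trivially, so two generators suffice (`thetaLaw_of_generators`). The commutator of the
generators is `d β₀` with `d ≥ 1`, so level `r` amounts to `r d` zeros on the curve. When `r d ≥ 3`,
a product of translates of one basic theta function, with a prescribed sum of the shifts, can vanish
at one given point and not at another (`exists_isTheta_separating`). Conjugation carries this to the
other curve, which gives (i).

Two points of 𝐖 with the same image differ by some `δ ≠ 0` in the second coordinate only, and the
ratio of the values of `g` depends on `f`, `f'` only through `ψ δ`. Translating theta functions
varies `ψ`, which gives (ii).

For (iii), represent points by `(x, y - γ)` with `x`, `y` bounded and `γ ∈ R`. The transformation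
law gives `|g| = |f x| |f' y|` times an exponential that grows like a Gaussian in `‖γ‖`, and `‖γ‖`
is unbounded on a sequence without cluster point. -/

noncomputable section

/-! ### Charts of 𝐖 and descent of invariant functions -/

theorem QuotW.isLocalHomeomorph_mk (R : AddSubgroup ℂ) [DiscreteTopology R] :
    IsLocalHomeomorph (fun p : ℂ × ℂ => QuotW.mk R p.1 p.2) :=
  (_root_.isAddQuotientCoveringMap_quotientMk_of_properlyDiscontinuousVAdd (G := twistedLattice R)
    (E := ℂ × ℂ)).isCoveringMap.isLocalHomeomorph

theorem QuotW.continuous_mk (R : AddSubgroup ℂ) [DiscreteTopology R] :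
    Continuous (fun p : ℂ × ℂ => QuotW.mk R p.1 p.2) :=
  (QuotW.isLocalHomeomorph_mk R).continuous

theorem QuotW.mk_surjective {R : AddSubgroup ℂ} (x : QuotW R) :
    ∃ z z' : ℂ, QuotW.mk R z z' = x := by
  obtain ⟨⟨z, z'⟩, rfl⟩ := Quotient.exists_rep x
  exact ⟨z, z', rfl⟩

theorem QuotW.mk_eq_mk {R : AddSubgroup ℂ} {z z' w w' : ℂ} :
    QuotW.mk R z z' = QuotW.mk R w w' ↔ ∃ α ∈ R, z = w + conj α ∧ z' = w' - α := by
  refine (Quotient.eq (r := AddAction.orbitRel (twistedLattice R) (ℂ × ℂ))).trans ?_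
  rw [AddAction.orbitRel_apply, AddAction.mem_orbit_iff]
  constructor
  · rintro ⟨⟨p, hp⟩, h⟩
    obtain ⟨α, hα, rfl⟩ := mem_twistedLattice.1 hp
    have h1 := congrArg Prod.fst h
    have h2 := congrArg Prod.snd h
    refine ⟨α, hα, ?_, ?_⟩
    · exact h1.symm.trans (add_comm _ _)
    · exact h2.symm.trans (neg_add_eq_sub _ _)
  · rintro ⟨α, hα, rfl, rfl⟩
    refine ⟨⟨(conj α, -α), mem_twistedLattice.2 ⟨α, hα, rfl⟩⟩, ?_⟩
    refine Prod.ext ?_ ?_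
    · exact add_comm _ _
    · rw [sub_eq_add_neg]; exact add_comm _ _

theorem IsLocalHomeomorph.symm_apply_of_mem_atlas {M N : Type*} [TopologicalSpace M]
    [TopologicalSpace N] {f : M → N} (hf : IsLocalHomeomorph f) (hs : Function.Surjective f)
    {e : OpenPartialHomeomorph N M}
    (he : e ∈ (hf.chartedSpace (H := M) hs).atlas) (p : M) : e.symm p = f p := by
  obtain ⟨q, rfl⟩ := he
  simp [chartAt_self_eq]

/-- The local inverses of the covering map from `ℂ × ℂ` are the charts of `𝐖`. -/
theorem QuotW.symm_apply_of_mem_atlas {R : AddSubgroup ℂ} [DiscreteTopology R]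
    {e : OpenPartialHomeomorph (QuotW R) (ℂ × ℂ)} (he : e ∈ atlas (ℂ × ℂ) (QuotW R))
    (p : ℂ × ℂ) : e.symm p = QuotW.mk R p.1 p.2 := by
  exact IsLocalHomeomorph.symm_apply_of_mem_atlas (QuotW.isLocalHomeomorph_mk R)
    Quotient.mk_surjective he p

theorem QuotW.mk_apply_of_mem_atlas {R : AddSubgroup ℂ} [DiscreteTopology R]
    {e : OpenPartialHomeomorph (QuotW R) (ℂ × ℂ)} (he : e ∈ atlas (ℂ × ℂ) (QuotW R))
    {x : QuotW R} (hx : x ∈ e.source) : QuotW.mk R (e x).1 (e x).2 = x := by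
  rw [← QuotW.symm_apply_of_mem_atlas he, e.left_inv hx]

/-- A change of charts minus the identity is continuous with values in the discrete twisted lattice,
so it is locally constant: changes of charts are locally translations. -/
theorem QuotW.isManifold (R : AddSubgroup ℂ) [DiscreteTopology R] :
    IsManifold 𝓘(ℂ, ℂ × ℂ) ω (QuotW R) := by
  refine isManifold_of_contDiffOn _ _ _ fun e e' he he' => ?_
  simp only [modelWithCornersSelf_coe, modelWithCornersSelf_coe_symm, Function.comp_id,
    Function.id_comp, Set.preimage_id, Set.range_id, Set.inter_univ]
  intro x hx
  refine ContDiffAt.contDiffWithinAt ?_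
  have hopen := (e.symm.trans e').open_source
  set h : ℂ × ℂ → ℂ × ℂ := fun y => (e.symm.trans e') y - y with hdef
  have hmem : ∀ y ∈ (e.symm.trans e').source, h y ∈ twistedLattice R := by
    intro y hy
    have hy' : e.symm y ∈ e'.source := by simpa using hy.2
    have h1 := QuotW.mk_apply_of_mem_atlas he' hy'
    rw [QuotW.symm_apply_of_mem_atlas he, QuotW.mk_eq_mk] at h1
    obtain ⟨α, hα, h2, h3⟩ := h1
    refine mem_twistedLattice.2 ⟨α, hα, ?_⟩
    refine Prod.ext ?_ ?_
    · simp [hdef, QuotW.symm_apply_of_mem_atlas he, h2]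
    · simp [hdef, QuotW.symm_apply_of_mem_atlas he, h3]
  have hcont : ContinuousAt h x :=
    ((e.symm.trans e').continuousAt hx).sub continuousAt_id
  obtain ⟨U, hU, hUR⟩ : ∃ U ∈ 𝓝 (h x), ∀ y ∈ U, y ∈ twistedLattice R → y = h x := by
    have h1 : ({⟨h x, hmem x hx⟩} : Set (twistedLattice R)) ∈ 𝓝 (⟨h x, hmem x hx⟩ :
        twistedLattice R) := by simp
    rw [mem_nhds_subtype] at h1
    obtain ⟨U, hU, hUR⟩ := h1
    refine ⟨U, hU, fun y hy hyR => ?_⟩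
    have h2 : (⟨y, hyR⟩ : twistedLattice R) ∈ ({⟨h x, hmem x hx⟩} : Set (twistedLattice R)) :=
      hUR hy
    exact congrArg Subtype.val (Set.mem_singleton_iff.1 h2)
  have heq : (e.symm.trans e') =ᶠ[𝓝 x] fun y => y + h x := by
    filter_upwards [hcont hU, hopen.mem_nhds hx] with y hy hys
    rw [← hUR _ hy (hmem y hys)]
    simp [hdef]
  exact (contDiffAt_id.add contDiffAt_const).congr_of_eventuallyEq heq

theorem QuotW.eventuallyEq_comp_chartAt {R : AddSubgroup ℂ} [DiscreteTopology R] {V : Type*}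
    {F : ℂ × ℂ → V} {G : QuotW R → V} (h : ∀ z z', G (QuotW.mk R z z') = F (z, z'))
    (x : QuotW R) : G =ᶠ[𝓝 x] F ∘ chartAt (ℂ × ℂ) x := by
  filter_upwards [chart_source_mem_nhds (ℂ × ℂ) x] with y hy
  rw [Function.comp_apply, ← h, QuotW.mk_apply_of_mem_atlas (chart_mem_atlas _ x) hy]

section Descent

variable {R : AddSubgroup ℂ} [DiscreteTopology R] {V : Type*} [NormedAddCommGroup V]
  [NormedSpace ℂ V] {F : ℂ × ℂ → V} {G : QuotW R → V}

theorem QuotW.mdifferentiable_of_mk (hF : Differentiable ℂ F)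
    (h : ∀ z z', G (QuotW.mk R z z') = F (z, z')) :
    MDifferentiable 𝓘(ℂ, ℂ × ℂ) 𝓘(ℂ, V) G := by
  intro x
  have := QuotW.isManifold R
  have h1 : MDifferentiableAt 𝓘(ℂ, ℂ × ℂ) 𝓘(ℂ, ℂ × ℂ) (chartAt (ℂ × ℂ) x) x :=
    mdifferentiableAt_atlas (chart_mem_atlas _ x) (mem_chart_source _ x)
  exact ((hF _).mdifferentiableAt.comp x h1).congr_of_eventuallyEq
    (QuotW.eventuallyEq_comp_chartAt h x)

theorem QuotW.mfderiv_bijective_of_mk (hF : Differentiable ℂ F)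
    (hF' : ∀ p, Function.Bijective (fderiv ℂ F p))
    (h : ∀ z z', G (QuotW.mk R z z') = F (z, z')) (x : QuotW R) :
    Function.Bijective (mfderiv 𝓘(ℂ, ℂ × ℂ) 𝓘(ℂ, V) G x) := by
  have := QuotW.isManifold R
  have h1 : MDifferentiableAt 𝓘(ℂ, ℂ × ℂ) 𝓘(ℂ, ℂ × ℂ) (chartAt (ℂ × ℂ) x) x :=
    mdifferentiableAt_atlas (chart_mem_atlas _ x) (mem_chart_source _ x)
  rw [(QuotW.eventuallyEq_comp_chartAt h x).mfderiv_eq,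
    mfderiv_comp x (hF _).mdifferentiableAt h1, mfderiv_eq_fderiv]
  exact (hF' _).comp ((mdifferentiable_chart x).mfderiv_bijective (mem_chart_source _ x))

end Descent

theorem QuotW.exists_mdifferentiable {R : AddSubgroup ℂ} [DiscreteTopology R] {V : Type*}
    [NormedAddCommGroup V] [NormedSpace ℂ V] {F : ℂ × ℂ → V} (hF : Differentiable ℂ F)
    (hinv : ∀ α ∈ R, ∀ z z' : ℂ, F (z + conj α, z' - α) = F (z, z')) :
    ∃ G : QuotW R → V, MDifferentiable 𝓘(ℂ, ℂ × ℂ) 𝓘(ℂ, V) G ∧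
      ∀ z z', G (QuotW.mk R z z') = F (z, z') := by
  let G : QuotW R → V := Quotient.lift F (by
    rintro ⟨z, z'⟩ ⟨w, w'⟩ h
    obtain ⟨α, hα, rfl, rfl⟩ := QuotW.mk_eq_mk.1 (Quotient.sound h)
    exact hinv α hα w w')
  have h : ∀ z z', G (QuotW.mk R z z') = F (z, z') := fun z z' => rfl
  exact ⟨G, QuotW.mdifferentiable_of_mk hF h, h⟩

/-! ### A theta function as an infinite product -/

/-- The product `∏ (1 - qⁿ w)` over `n ≥ 0`. -/
def qProduct (q w : ℂ) : ℂ := ∏' n : ℕ, (1 + -(q ^ n * w))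

theorem summable_norm_qProduct {q : ℂ} (hq : ‖q‖ < 1) (w : ℂ) :
    Summable fun n : ℕ => ‖-(q ^ n * w)‖ := by
  simp only [norm_neg, norm_mul, norm_pow]
  exact (summable_geometric_of_lt_one (norm_nonneg _) hq).mul_right _

theorem qProduct_eq_mul {q : ℂ} (hq : ‖q‖ < 1) (w : ℂ) :
    qProduct q w = (1 - w) * qProduct q (q * w) := by
  unfold qProduct
  rw [tprod_eq_zero_mul']
  · simp [pow_succ, mul_assoc, sub_eq_add_neg]
  · have := multipliable_one_add_of_summable (summable_norm_qProduct hq (q * w))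
    simpa [pow_succ, mul_assoc] using this

theorem qProduct_eq_zero_iff {q : ℂ} (hq : ‖q‖ < 1) (w : ℂ) :
    qProduct q w = 0 ↔ ∃ n : ℕ, q ^ n * w = 1 := by
  constructor
  · intro h
    by_contra! hne
    refine tprod_one_add_ne_zero_of_summable (fun n h0 => hne n ?_)
      (summable_norm_qProduct hq w) h
    linear_combination -h0
  · rintro ⟨n, hn⟩
    exact tprod_of_exists_eq_zero ⟨n, by rw [hn]; ring⟩

theorem differentiable_qProduct {q : ℂ} (hq : ‖q‖ < 1) : Differentiable ℂ (qProduct q) := by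
  intro w
  have hloc : HasProdLocallyUniformlyOn (fun (n : ℕ) (x : ℂ) => 1 + -(q ^ n * x))
      (qProduct q) (Metric.ball 0 (‖w‖ + 1)) := by
    refine Summable.hasProdLocallyUniformlyOn_nat_one_add Metric.isOpen_ball
      (u := fun n : ℕ => ‖q‖ ^ n * (‖w‖ + 1))
      ((summable_geometric_of_lt_one (norm_nonneg _) hq).mul_right _)
      (.of_forall fun n x hx => ?_) (fun n => by fun_prop)
    rw [norm_neg, norm_mul, norm_pow]
    gcongr
    exact (mem_ball_zero_iff.1 hx).le
  refine (hloc.differentiableOn (.of_forall fun s => ?_) Metric.isOpen_ball).differentiableAt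
    (Metric.isOpen_ball.mem_nhds (by simp))
  simpa [Finset.prod_fn] using DifferentiableOn.finsetProd (fun _ _ => by fun_prop)

/-- The theta function of the lattice `ℤ + ℤ τ` that vanishes at the lattice points, as a product. -/
def thetaProduct (τ z : ℂ) : ℂ :=
  qProduct (exp (2 * Real.pi * I * τ)) (exp (2 * Real.pi * I * z)) *
    qProduct (exp (2 * Real.pi * I * τ)) (exp (2 * Real.pi * I * (τ - z)))

theorem norm_exp_two_pi_I_mul_lt_one {τ : ℂ} (hτ : 0 < τ.im) :
    ‖exp (2 * Real.pi * I * τ)‖ < 1 := by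
  rw [Complex.norm_exp, Real.exp_lt_one_iff]
  have := mul_pos Real.pi_pos hτ
  simp
  nlinarith

theorem differentiable_thetaProduct {τ : ℂ} (hτ : 0 < τ.im) :
    Differentiable ℂ (thetaProduct τ) := by
  have h := differentiable_qProduct (norm_exp_two_pi_I_mul_lt_one hτ)
  unfold thetaProduct
  fun_prop

theorem thetaProduct_add_one (τ z : ℂ) : thetaProduct τ (z + 1) = thetaProduct τ z := by
  unfold thetaProduct
  have h1 : exp (2 * Real.pi * I * (z + 1)) = exp (2 * Real.pi * I * z) := by
    rw [mul_add, mul_one, exp_add, exp_two_pi_mul_I, mul_one]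
  have h2 : exp (2 * Real.pi * I * (τ - (z + 1))) = exp (2 * Real.pi * I * (τ - z)) := by
    rw [show 2 * Real.pi * I * (τ - (z + 1)) = 2 * Real.pi * I * (τ - z) - 2 * Real.pi * I by ring,
      exp_sub, exp_two_pi_mul_I, div_one]
  rw [h1, h2]

/-- With `w = exp(2πi z)`, the shift by `τ` removes the factor `1 - w` from the first product and
adds `1 - w⁻¹` to the second; the quotient of the two is `-w⁻¹`. -/
theorem thetaProduct_add_tau {τ : ℂ} (hτ : 0 < τ.im) (z : ℂ) :
    thetaProduct τ (z + τ) = -exp (-(2 * Real.pi * I * z)) * thetaProduct τ z := by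
  unfold thetaProduct
  have hq := norm_exp_two_pi_I_mul_lt_one hτ
  have hne := exp_ne_zero (2 * Real.pi * I * z)
  rw [qProduct_eq_mul hq (exp (2 * Real.pi * I * z)),
    qProduct_eq_mul hq (exp (2 * Real.pi * I * (τ - (z + τ)))), ← exp_add, ← exp_add]
  have h1 : 2 * Real.pi * I * (τ - (z + τ)) = -(2 * Real.pi * I * z) := by ring
  have h2 : 2 * Real.pi * I * τ + -(2 * Real.pi * I * z) = 2 * Real.pi * I * (τ - z) := by ring
  rw [h1, h2, mul_add, add_comm (2 * Real.pi * I * z), exp_neg]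
  field_simp
  ring

theorem thetaProduct_zero {τ : ℂ} (hτ : 0 < τ.im) : thetaProduct τ 0 = 0 := by
  unfold thetaProduct
  rw [(qProduct_eq_zero_iff (norm_exp_two_pi_I_mul_lt_one hτ) _).2 ⟨0, by simp⟩, zero_mul]

theorem exists_of_thetaProduct_eq_zero {τ : ℂ} (hτ : 0 < τ.im) {z : ℂ}
    (h : thetaProduct τ z = 0) : ∃ m n : ℤ, z = m + n * τ := by
  have hq := norm_exp_two_pi_I_mul_lt_one hτ
  have hpi := two_pi_I_ne_zero
  rcases mul_eq_zero.1 h with h | h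
  · obtain ⟨n, hn⟩ := (qProduct_eq_zero_iff hq _).1 h
    rw [← exp_nat_mul, ← exp_add, exp_eq_one_iff] at hn
    obtain ⟨k, hk⟩ := hn
    refine ⟨k, -n, mul_left_cancel₀ hpi ?_⟩
    push_cast
    linear_combination hk
  · obtain ⟨n, hn⟩ := (qProduct_eq_zero_iff hq _).1 h
    rw [← exp_nat_mul, ← exp_add, exp_eq_one_iff] at hn
    obtain ⟨k, hk⟩ := hn
    refine ⟨-k, n + 1, mul_left_cancel₀ hpi ?_⟩
    push_cast
    linear_combination -hk

/-! ### Lattice bases and linear coordinates -/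

/-- A lattice in `ℂ` has a `ℤ`-basis with a prescribed orientation. -/
theorem exists_lattice_basis (R : AddSubgroup ℂ) [DiscreteTopology R]
    (hspan : Submodule.span ℝ (R : Set ℂ) = ⊤) :
    ∃ α₁ ∈ R, ∃ α₂ ∈ R, 0 < (α₁ * conj α₂).im ∧ ∀ α ∈ R, ∃ m n : ℤ, α = m * α₁ + n * α₂ := by
  let L : Submodule ℤ ℂ := AddSubgroup.toIntSubmodule R
  have : DiscreteTopology L := inferInstanceAs (DiscreteTopology R)
  have : IsZLattice ℝ L := ⟨hspan⟩
  have := ZLattice.module_free ℝ L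
  have := ZLattice.module_finite ℝ L
  have hrank : Module.finrank ℤ L = 2 := by
    rw [ZLattice.rank ℝ L, Complex.finrank_real_complex]
  let b : Module.Basis (Fin 2) ℤ L := Module.finBasisOfFinrankEq ℤ L hrank
  have hrep : ∀ α ∈ R, ∃ m n : ℤ, α = m * (b 0 : ℂ) + n * (b 1 : ℂ) := by
    intro α hα
    have h := congrArg Subtype.val (b.sum_repr ⟨α, hα⟩)
    rw [Fin.sum_univ_two] at h
    exact ⟨_, _, by simpa using h.symm⟩
  have him : ((b 0 : ℂ) * conj (b 1 : ℂ)).im ≠ 0 := by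
    intro h0
    let b' := b.ofZLatticeBasis ℝ L
    have hli := b'.linearIndependent
    rw [Fintype.linearIndependent_iff] at hli
    simp only [Fin.sum_univ_two, b', Module.Basis.ofZLatticeBasis_apply] at hli
    have hne : (b 0 : ℂ) ≠ 0 := by
      intro h
      have := hli ![1, 0] (by simp [h]) 0
      simp at this
    -- If `b₀ conj b₁` were real, then `Re(b₀ conj b₁) b₀ = |b₀|² b₁` would be a real linear
    -- relation.
    have h2 := hli ![((b 0 : ℂ) * conj (b 1 : ℂ)).re, -normSq (b 0 : ℂ)] (by
      apply Complex.ext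
      · simp [normSq_apply] at h0 ⊢
        linear_combination -(b 0 : ℂ).im * h0
      · simp [normSq_apply] at h0 ⊢
        linear_combination (b 0 : ℂ).re * h0) 1
    simp [hne] at h2
  rcases lt_or_gt_of_ne him with h | h
  · refine ⟨b 1, (b 1).2, b 0, (b 0).2, ?_, fun α hα => ?_⟩
    · simp at h ⊢
      linarith
    · obtain ⟨m, n, h⟩ := hrep α hα
      exact ⟨n, m, by rw [h, add_comm]⟩
  · exact ⟨b 0, (b 0).2, b 1, (b 1).2, h, hrep⟩

/-- Linear coordinates of `ℂ × ℂ` in which the translations by the twisted lattice are those by the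
vectors with integral entries. -/
theorem exists_twistedLattice_coordinates (R : AddSubgroup ℂ) [DiscreteTopology R]
    (hspan : Submodule.span ℝ (R : Set ℂ) = ⊤) :
    ∃ U : (ℂ × ℂ) ≃L[ℂ] (ℂ × ℂ),
      (∀ α ∈ R, ∃ m n : ℤ, U (conj α, -α) = ((m : ℂ), (n : ℂ))) ∧
      ∀ m n : ℤ, ∃ α ∈ R, U.symm ((m : ℂ), (n : ℂ)) = (conj α, -α) := by
  obtain ⟨α₁, h₁, α₂, h₂, him, hrep⟩ := exists_lattice_basis R hspan
  obtain ⟨D, hD⟩ : ∃ D, D = α₁ * conj α₂ - conj α₁ * α₂ := ⟨_, rfl⟩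
  have hD0 : D ≠ 0 := by
    intro h
    have := congrArg Complex.im (hD.symm.trans h)
    simp at this him
    linarith
  -- The inverse sends `w` to `w₁ (conj α₁, -α₁) + w₂ (conj α₂, -α₂)`; the forward map is Cramer's
  -- rule, with `D = 2i Im(α₁ conj α₂) ≠ 0`.
  let e : (ℂ × ℂ) ≃ₗ[ℂ] (ℂ × ℂ) :=
    { toFun := fun p => (-(α₂ * p.1 + conj α₂ * p.2) / D, (α₁ * p.1 + conj α₁ * p.2) / D)
      map_add' := fun p q => by
        refine Prod.ext ?_ ?_ <;> simp <;> ring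
      map_smul' := fun c p => by
        refine Prod.ext ?_ ?_ <;> simp <;> ring
      invFun := fun w => (w.1 * conj α₁ + w.2 * conj α₂, -(w.1 * α₁ + w.2 * α₂))
      left_inv := fun p => by
        refine Prod.ext ?_ ?_
        · field_simp
          rw [hD]
          ring
        · field_simp
          rw [hD]
          ring
      right_inv := fun w => by
        refine Prod.ext ?_ ?_
        · field_simp
          rw [hD]
          ring
        · field_simp
          rw [hD]
          ring }
  have hsymm : ∀ m n : ℤ, e.symm ((m : ℂ), (n : ℂ)) =
      (conj (m * α₁ + n * α₂), -(m * α₁ + n * α₂)) := by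
    intro m n
    change ((m : ℂ) * conj α₁ + (n : ℂ) * conj α₂, -((m : ℂ) * α₁ + (n : ℂ) * α₂)) = _
    simp
  refine ⟨e.toContinuousLinearEquiv, fun α hα => ?_, fun m n => ?_⟩
  · obtain ⟨m, n, rfl⟩ := hrep α hα
    refine ⟨m, n, ?_⟩
    rw [← hsymm]
    exact e.apply_symm_apply _
  · refine ⟨m * α₁ + n * α₂, R.add_mem ?_ ?_, hsymm m n⟩
    · simpa using R.zsmul_mem h₁ m
    · simpa using R.zsmul_mem h₂ n

/-! ### The Stein property -/

theorem exp_two_pi_I_mul_add_intCast (x : ℂ) (m : ℤ) :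
    exp (2 * Real.pi * I * (x + m)) = exp (2 * Real.pi * I * x) := by
  rw [mul_add, exp_add, mul_comm _ (m : ℂ), exp_int_mul_two_pi_mul_I, mul_one]

theorem exp_two_pi_I_mul_eq_iff {x y : ℂ} :
    exp (2 * Real.pi * I * x) = exp (2 * Real.pi * I * y) ↔ ∃ m : ℤ, x = y + m := by
  refine ⟨fun h => ?_, ?_⟩
  · obtain ⟨m, hm⟩ := exp_eq_exp_iff_exists_int.1 h
    exact ⟨m, mul_left_cancel₀ two_pi_I_ne_zero (by linear_combination hm)⟩
  · rintro ⟨m, rfl⟩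
    exact exp_two_pi_I_mul_add_intCast y m

/-- The norms are `exp(∓2π Im x)`, each at least `1 ∓ 2π Im x`. This turns bounds on a coordinate of
ℂˣ and its inverse into a bound on the logarithm. -/
theorem abs_im_le_of_norm_exp_le {x : ℂ} {C : ℝ} (h₁ : ‖exp (2 * Real.pi * I * x)‖ ≤ C)
    (h₂ : ‖exp (2 * Real.pi * I * -x)‖ ≤ C) : |x.im| ≤ C := by
  rw [Complex.norm_exp] at h₁ h₂
  have e₁ := (Real.add_one_le_exp _).trans h₁
  have e₂ := (Real.add_one_le_exp _).trans h₂
  simp at e₁ e₂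
  have hpi := Real.pi_gt_three
  rw [abs_le]
  constructor <;> by_contra! hcon
  · nlinarith [mul_nonneg (sub_nonneg.2 hpi.le) (abs_nonneg x.im), abs_le.1 (le_refl |x.im|)]
  · nlinarith [mul_nonneg (sub_nonneg.2 hpi.le) (abs_nonneg x.im), abs_le.1 (le_refl |x.im|)]

theorem hasFDerivAt_exp_prod (w : ℂ × ℂ) :
    HasFDerivAt (fun w : ℂ × ℂ =>
        (exp (2 * Real.pi * I * w.1), exp (2 * Real.pi * I * w.2)))
      (((exp (2 * Real.pi * I * w.1) * (2 * Real.pi * I)) • ContinuousLinearMap.fst ℂ ℂ ℂ).prod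
        ((exp (2 * Real.pi * I * w.2) * (2 * Real.pi * I)) • ContinuousLinearMap.snd ℂ ℂ ℂ)) w := by
  have h : ∀ x : ℂ, HasDerivAt (fun x : ℂ => exp (2 * Real.pi * I * x))
      (exp (2 * Real.pi * I * x) * (2 * Real.pi * I)) x := fun x => by
    simpa using ((hasDerivAt_id x).const_mul (2 * Real.pi * I)).cexp
  exact ((h w.1).comp_hasFDerivAt w hasFDerivAt_fst).prodMk
    ((h w.2).comp_hasFDerivAt w hasFDerivAt_snd)

theorem isSteinManifold_quotW (R : AddSubgroup ℂ) [DiscreteTopology R]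
    (hspan : Submodule.span ℝ (R : Set ℂ) = ⊤) : IsSteinManifold (ℂ × ℂ) (QuotW R) := by
  obtain ⟨U, hU, hU'⟩ := exists_twistedLattice_coordinates R hspan
  have hUadd : ∀ α ∈ R, ∃ m n : ℤ, ∀ z z' : ℂ,
      U (z + conj α, z' - α) = U (z, z') + ((m : ℂ), (n : ℂ)) := by
    intro α hα
    obtain ⟨m, n, h⟩ := hU α hα
    refine ⟨m, n, fun z z' => ?_⟩
    rw [← h, ← map_add, Prod.mk_add_mk, ← sub_eq_add_neg]
  have hmk : ∀ (w : ℂ × ℂ) (m n : ℤ),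
      QuotW.mk R (U.symm (w + ((m : ℂ), (n : ℂ)))).1 (U.symm (w + ((m : ℂ), (n : ℂ)))).2 =
        QuotW.mk R (U.symm w).1 (U.symm w).2 := by
    intro w m n
    obtain ⟨α, hα, h⟩ := hU' m n
    refine QuotW.mk_eq_mk.2 ⟨α, hα, ?_, ?_⟩
    · rw [map_add, h, Prod.fst_add]
    · rw [map_add, h, Prod.snd_add, sub_eq_add_neg]
  -- These are the Laurent monomials on (ℂˣ)²; negative exponents are needed to bound imaginary
  -- parts from both sides.
  have hG : ∀ k l : ℤ, ∃ G : QuotW R → ℂ, MDifferentiable 𝓘(ℂ, ℂ × ℂ) 𝓘(ℂ, ℂ) G ∧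
      ∀ z z', G (QuotW.mk R z z') =
        exp (2 * Real.pi * I * (k * (U (z, z')).1 + l * (U (z, z')).2)) := by
    intro k l
    refine QuotW.exists_mdifferentiable
      (F := fun p => exp (2 * Real.pi * I * (k * (U p).1 + l * (U p).2))) (by fun_prop) ?_
    intro α hα z z'
    obtain ⟨m, n, h⟩ := hUadd α hα
    simp only [h, Prod.fst_add, Prod.snd_add]
    refine Eq.trans ?_ (exp_two_pi_I_mul_add_intCast _ (k * m + l * n))
    push_cast
    congr 1
    ring
  refine ⟨QuotW.isManifold R, ?_, ?_, fun K hK => ?_, fun x y hxy => ?_, fun x => ?_⟩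
  · exact inferInstanceAs (T2Space (AddAction.orbitRel.Quotient (twistedLattice R) (ℂ × ℂ)))
  · exact ContinuousConstVAdd.secondCountableTopology (Γ := twistedLattice R) (T := ℂ × ℂ)
  · have hbound : ∀ G : QuotW R → ℂ, MDifferentiable 𝓘(ℂ, ℂ × ℂ) 𝓘(ℂ, ℂ) G →
        ∃ C, ∀ y ∈ K, ‖G y‖ ≤ C := fun G hG =>
      hK.exists_bound_of_continuousOn hG.continuous.continuousOn
    have hcoord : ∀ k l : ℤ, ∃ C, ∀ z z' : ℂ, QuotW.mk R z z' ∈ {x : QuotW R | ∀ f : QuotW R → ℂ,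
        MDifferentiable 𝓘(ℂ, ℂ × ℂ) 𝓘(ℂ, ℂ) f → ∀ C : ℝ, (∀ y ∈ K, ‖f y‖ ≤ C) → ‖f x‖ ≤ C} →
        |(k * (U (z, z')).1 + l * (U (z, z')).2).im| ≤ C := by
      intro k l
      obtain ⟨G, hGd, hGe⟩ := hG k l
      obtain ⟨H, hHd, hHe⟩ := hG (-k) (-l)
      obtain ⟨C, hC⟩ := hbound G hGd
      obtain ⟨C', hC'⟩ := hbound H hHd
      refine ⟨max C C', fun z z' hx => abs_im_le_of_norm_exp_le ?_ ?_⟩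
      · rw [← hGe]
        exact (hx G hGd C hC).trans (le_max_left _ _)
      · have := (hx H hHd C' hC').trans (le_max_right C C')
        rwa [hHe, show ((-k : ℤ) : ℂ) * (U (z, z')).1 + ((-l : ℤ) : ℂ) * (U (z, z')).2 =
          -(k * (U (z, z')).1 + l * (U (z, z')).2) by push_cast; ring] at this
    obtain ⟨C₁, h₁⟩ := hcoord 1 0
    obtain ⟨C₂, h₂⟩ := hcoord 0 1
    -- On the hull of `K` the imaginary parts of both coordinates are bounded, and integral
    -- translations bring the real parts into `[0, 1]`. So the hull is a closed subset of the image
    -- of this compact box.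
    have hcpt : IsCompact ((fun w : ℂ × ℂ => QuotW.mk R (U.symm w).1 (U.symm w).2) ''
        ((Set.Icc 0 1 ×ℂ Set.Icc (-C₁) C₁) ×ˢ (Set.Icc 0 1 ×ℂ Set.Icc (-C₂) C₂))) :=
      ((isCompact_Icc.reProdIm isCompact_Icc).prod (isCompact_Icc.reProdIm isCompact_Icc)).image
        ((QuotW.continuous_mk R).comp U.symm.continuous)
    refine hcpt.of_isClosed_subset ?_ ?_
    · simp only [Set.ofPred_forall]
      refine isClosed_iInter fun f => isClosed_iInter fun hf => isClosed_iInter fun C =>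
        isClosed_iInter fun _ => isClosed_le hf.continuous.norm continuous_const
    · intro x hx
      obtain ⟨z, z', rfl⟩ := QuotW.mk_surjective x
      have b₁ := h₁ z z' hx
      have b₂ := h₂ z z' hx
      refine ⟨U (z, z') + (((-⌊(U (z, z')).1.re⌋ : ℤ) : ℂ), ((-⌊(U (z, z')).2.re⌋ : ℤ) : ℂ)), ?_, ?_⟩
      · simp only [Set.mem_prod, mem_reProdIm, Set.mem_Icc, Prod.fst_add, Prod.snd_add]
        simp [abs_le] at b₁ b₂
        have f₁ := Int.floor_le (U (z, z')).1.re
        have f₂ := Int.floor_le (U (z, z')).2.re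
        have g₁ := (Int.lt_floor_add_one (U (z, z')).1.re).le
        have g₂ := (Int.lt_floor_add_one (U (z, z')).2.re).le
        refine ⟨⟨⟨?_, ?_⟩, ?_, ?_⟩, ⟨?_, ?_⟩, ?_, ?_⟩ <;> simp <;> linarith
      · simp only [hmk, U.symm_apply_apply]
  · by_contra! hcon
    obtain ⟨z, z', rfl⟩ := QuotW.mk_surjective x
    obtain ⟨w, w', rfl⟩ := QuotW.mk_surjective y
    obtain ⟨G, hGd, hGe⟩ := hG 1 0
    obtain ⟨H, hHd, hHe⟩ := hG 0 1
    have hg := hcon G hGd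
    have hh := hcon H hHd
    rw [hGe, hGe, exp_two_pi_I_mul_eq_iff] at hg
    rw [hHe, hHe, exp_two_pi_I_mul_eq_iff] at hh
    obtain ⟨m, hm⟩ := hg
    obtain ⟨n, hn⟩ := hh
    have h : U (z, z') = U (w, w') + ((m : ℂ), (n : ℂ)) := by
      refine Prod.ext ?_ ?_
      · simpa using hm
      · simpa using hn
    have := hmk (U (w, w')) m n
    rw [← h, U.symm_apply_apply, U.symm_apply_apply] at this
    exact hxy this
  · have hF : ∀ p, HasFDerivAt (fun p : ℂ × ℂ =>
        (exp (2 * Real.pi * I * (U p).1), exp (2 * Real.pi * I * (U p).2))) _ p := fun p =>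
      (hasFDerivAt_exp_prod (U p)).comp p U.hasFDerivAt
    have hdiff : Differentiable ℂ (fun p : ℂ × ℂ =>
        (exp (2 * Real.pi * I * (U p).1), exp (2 * Real.pi * I * (U p).2))) :=
      fun p => (hF p).differentiableAt
    obtain ⟨G, hGd, hGe⟩ := QuotW.exists_mdifferentiable (R := R) hdiff (by
      intro α hα z z'
      obtain ⟨m, n, h⟩ := hUadd α hα
      simp only [h, Prod.fst_add, Prod.snd_add, exp_two_pi_I_mul_add_intCast])
    refine ⟨G, hGd, QuotW.mfderiv_bijective_of_mk hdiff (fun p => ?_) hGe x⟩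
    rw [(hF p).fderiv, ContinuousLinearMap.coe_comp]
    refine Function.Bijective.comp ?_ U.bijective
    have hne : ∀ x : ℂ, exp (2 * Real.pi * I * x) * (2 * Real.pi * I) ≠ 0 := fun x =>
      mul_ne_zero (exp_ne_zero _) two_pi_I_ne_zero
    constructor
    · rintro ⟨a, b⟩ ⟨c, d⟩ h
      have h1 := congrArg Prod.fst h
      have h2 := congrArg Prod.snd h
      exact Prod.ext (mul_left_cancel₀ (hne _) h1) (mul_left_cancel₀ (hne _) h2)
    · rintro ⟨a, b⟩
      exact ⟨(a / _, b / _), Prod.ext (mul_div_cancel₀ a (hne (U p).1))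
        (mul_div_cancel₀ b (hne (U p).2))⟩

/-! ### The Heisenberg group in Γ and its centre -/

namespace IsUnipotentIn

variable {Γ : Subgroup (GL (Fin 3) ℂ)} {α β α' β' : ℂ}

theorem mul (h : IsUnipotentIn Γ α β) (h' : IsUnipotentIn Γ α' β') :
    IsUnipotentIn Γ (α + α') (β + β' + α * conj α') := by
  obtain ⟨e, γ, hγ, hm⟩ := h
  obtain ⟨e', γ', hγ', hm'⟩ := h'
  refine ⟨?_, γ * γ', Γ.mul_mem hγ hγ', ?_⟩
  · simp only [map_add, map_mul, conj_conj]
    linear_combination e + e'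
  · rw [Units.val_mul, hm, hm']
    ext i j
    fin_cases i <;> fin_cases j <;> simp [Matrix.mul_apply, Fin.sum_univ_three] <;> ring

theorem inv (h : IsUnipotentIn Γ α β) : IsUnipotentIn Γ (-α) (conj β) := by
  obtain ⟨e, γ, hγ, hm⟩ := h
  refine ⟨?_, γ⁻¹, Γ.inv_mem hγ, ?_⟩
  · simp only [map_neg, conj_conj]
    linear_combination e
  · refine Units.inv_eq_of_mul_eq_one_right ?_
    rw [hm]
    ext i j
    fin_cases i <;> fin_cases j <;> simp [Matrix.mul_apply, Fin.sum_univ_three]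
    linear_combination e

theorem zero (Γ : Subgroup (GL (Fin 3) ℂ)) : IsUnipotentIn Γ 0 0 := by
  refine ⟨by simp, 1, Γ.one_mem, ?_⟩
  ext i j
  fin_cases i <;> fin_cases j <;> simp

theorem sub_right (h : IsUnipotentIn Γ α β) (h' : IsUnipotentIn Γ α β') :
    IsUnipotentIn Γ 0 (β' - β) := by
  have h1 := h'.mul h.inv
  rw [add_neg_cancel, map_neg] at h1
  convert h1 using 1
  linear_combination -h.1

end IsUnipotentIn

theorem IsLeastCentral.conj_eq {Γ : Subgroup (GL (Fin 3) ℂ)} {β₀ : ℂ}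
    (hβ₀ : IsLeastCentral Γ β₀) : conj β₀ = -β₀ := by
  have h := hβ₀.1.1
  rw [zero_mul] at h
  linear_combination h

theorem IsLeastCentral.ne_zero {Γ : Subgroup (GL (Fin 3) ℂ)} {β₀ : ℂ}
    (hβ₀ : IsLeastCentral Γ β₀) : β₀ ≠ 0 := by
  rintro rfl
  simpa using hβ₀.2.1

/-- The central elements of the unipotent radical that lie in `Γ` are the multiples of the least
one. -/
theorem IsLeastCentral.exists_eq_intCast_mul {Γ : Subgroup (GL (Fin 3) ℂ)} {β₀ β : ℂ}
    (hβ₀ : IsLeastCentral Γ β₀) (h : IsUnipotentIn Γ 0 β) : ∃ k : ℤ, β = k * β₀ := by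
  let Z : AddSubgroup ℂ :=
    { carrier := {β | IsUnipotentIn Γ 0 β}
      zero_mem' := IsUnipotentIn.zero Γ
      add_mem' := fun {x y} hx hy => by simpa using IsUnipotentIn.mul hx hy
      neg_mem' := fun {x} hx => by
        have h1 := IsUnipotentIn.inv hx
        have h2 : conj x = -x := by
          have := hx.1
          rw [zero_mul] at this
          linear_combination this
        rwa [neg_zero, h2] at h1 }
  obtain ⟨h0, hpos, hmin⟩ := hβ₀
  -- Division with remainder: the remainder is central in Γ with imaginary part in `[0, Im β₀)`, so
  -- minimality makes it zero.
  refine ⟨⌊β.im / β₀.im⌋, ?_⟩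
  have hmem : β - ⌊β.im / β₀.im⌋ * β₀ ∈ Z := by
    have := Z.sub_mem h (Z.zsmul_mem h0 ⌊β.im / β₀.im⌋)
    simpa using this
  have hre : ∀ x ∈ Z, x.re = 0 := fun x hx => by
    have := congrArg Complex.re hx.1
    simp at this
    linarith
  have him : (β - ⌊β.im / β₀.im⌋ * β₀).im = β.im - ⌊β.im / β₀.im⌋ * β₀.im := by simp
  have h1 : ⌊β.im / β₀.im⌋ * β₀.im ≤ β.im := (le_div_iff₀ hpos).1 (Int.floor_le _)
  have h2 : β.im < (⌊β.im / β₀.im⌋ + 1) * β₀.im := (div_lt_iff₀ hpos).1 (Int.lt_floor_add_one _)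
  have h3 : (β - ⌊β.im / β₀.im⌋ * β₀).im = 0 := by
    by_contra hne
    have hp : 0 < (β - ⌊β.im / β₀.im⌋ * β₀).im := lt_of_le_of_ne (by linarith) (Ne.symm hne)
    have := hmin _ hmem hp
    linarith
  exact sub_eq_zero.1 (Complex.ext (hre _ hmem) h3)

/-- The commutator of two elements of the unipotent radical. -/
theorem IsLeastCentral.exists_commutator {Γ : Subgroup (GL (Fin 3) ℂ)} {β₀ α₁ β₁ α₂ β₂ : ℂ}
    (hβ₀ : IsLeastCentral Γ β₀) (h₁ : IsUnipotentIn Γ α₁ β₁) (h₂ : IsUnipotentIn Γ α₂ β₂)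
    (hpos : 0 < (α₁ * conj α₂).im) :
    ∃ d : ℕ, 0 < d ∧ α₁ * conj α₂ - α₂ * conj α₁ = d * β₀ := by
  -- The products in both orders lie over `α₁ + α₂`, so their `β`-entries differ by a central
  -- element.
  have h := (h₂.mul h₁).sub_right (add_comm α₁ α₂ ▸ h₁.mul h₂)
  obtain ⟨k, hk⟩ := hβ₀.exists_eq_intCast_mul h
  have hk' : α₁ * conj α₂ - α₂ * conj α₁ = k * β₀ := by linear_combination hk
  have hkpos : 0 < k := by
    have him := congrArg Complex.im hk'
    simp at him hpos
    have : 0 < (k : ℝ) * β₀.im := by linarith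
    exact_mod_cast pos_of_mul_pos_left this hβ₀.2.1.le
  refine ⟨k.toNat, by omega, ?_⟩
  rw [hk']
  congr 1
  exact_mod_cast (Int.toNat_of_nonneg hkpos.le).symm

/-! ### Construction of theta functions -/

/-- The transformation law of a theta function for the element `(α, β)` of the unipotent radical. -/
def ThetaLaw (c : ℂ) (f : ℂ → ℂ) (α β : ℂ) : Prop :=
  ∀ z, f (z + conj α) = f z * exp (c * (α * z + β))

/-- The factor is a cocycle: evaluating `α z` at `z + conj α'` produces the term `α conj α'` of the
group law. -/
theorem ThetaLaw.mul {c : ℂ} {f : ℂ → ℂ} {α β α' β' : ℂ} (h : ThetaLaw c f α β)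
    (h' : ThetaLaw c f α' β') : ThetaLaw c f (α + α') (β + β' + α * conj α') := by
  intro z
  rw [map_add, add_comm (conj α), ← add_assoc, h, h', mul_assoc, ← exp_add]
  ring_nf

theorem ThetaLaw.inv {c : ℂ} {f : ℂ → ℂ} {α β : ℂ} (h : ThetaLaw c f α β)
    (hβ : β + conj β = α * conj α) : ThetaLaw c f (-α) (conj β) := by
  intro z
  have h1 := h (z + conj (-α))
  rw [map_neg, neg_add_cancel_right] at h1
  rw [h1, map_neg, mul_assoc, ← exp_add]
  have : c * (α * (z + -conj α) + β) + c * (-α * z + conj β) = 0 := by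
    linear_combination c * hβ
  rw [this, exp_zero, mul_one]

/-- It suffices to check the transformation law of a theta function on generators. -/
theorem thetaLaw_of_generators {Γ : Subgroup (GL (Fin 3) ℂ)} {β₀ c : ℂ} {r : ℕ}
    (hβ₀ : IsLeastCentral Γ β₀) (hc : c * β₀ = r * (2 * Real.pi * I)) {f : ℂ → ℂ}
    {α₁ β₁ α₂ β₂ : ℂ} (h₁ : IsUnipotentIn Γ α₁ β₁) (h₂ : IsUnipotentIn Γ α₂ β₂)
    (l₁ : ThetaLaw c f α₁ β₁) (l₂ : ThetaLaw c f α₂ β₂) {α β : ℂ}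
    (h : IsUnipotentIn Γ α β) (hα : ∃ m n : ℤ, α = m * α₁ + n * α₂) : ThetaLaw c f α β := by
  let H : AddSubgroup ℂ :=
    { carrier := {α | ∃ β, IsUnipotentIn Γ α β ∧ ThetaLaw c f α β}
      zero_mem' := ⟨0, IsUnipotentIn.zero Γ, fun z => by simp⟩
      add_mem' := fun {x y} hx hy => by
        obtain ⟨b, hb, hb'⟩ := hx
        obtain ⟨b', hc, hc'⟩ := hy
        exact ⟨_, hb.mul hc, hb'.mul hc'⟩
      neg_mem' := fun {x} hx => by
        obtain ⟨b, hb, hb'⟩ := hx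
        exact ⟨_, hb.inv, hb'.inv hb.1⟩ }
  have hmem : α ∈ H := by
    obtain ⟨m, n, rfl⟩ := hα
    have g₁ : α₁ ∈ H := ⟨β₁, h₁, l₁⟩
    have g₂ : α₂ ∈ H := ⟨β₂, h₂, l₂⟩
    simpa using H.add_mem (H.zsmul_mem g₁ m) (H.zsmul_mem g₂ n)
  obtain ⟨β', hβ', law⟩ := hmem
  -- The subgroup `H` supplies the law for some `β'` over `α`. Replacing `β'` by `β` changes the
  -- exponent by `c k β₀ = 2πi r k`, which is harmless.
  obtain ⟨k, hk⟩ := hβ₀.exists_eq_intCast_mul (hβ'.sub_right h)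
  intro z
  rw [law z]
  congr 1
  rw [exp_eq_exp_iff_exists_int]
  refine ⟨-(k * r), ?_⟩
  push_cast
  linear_combination -c * hk - k * hc

/-- The quotient is `α₁ conj α₂ / |α₁|²`; the orientation of the basis is chosen for this, so that
the theta product converges. -/
theorem im_conj_div_conj_pos {α₁ α₂ : ℂ} (hpos : 0 < (α₁ * conj α₂).im) :
    0 < (conj α₂ / conj α₁).im := by
  have h0 : α₁ ≠ 0 := by
    rintro rfl
    simp at hpos
  have h1 : conj α₁ ≠ 0 := by simpa using h0
  have hn : conj α₂ / conj α₁ = α₁ * conj α₂ / ((normSq α₁ : ℝ) : ℂ) := by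
    rw [← mul_conj]
    field_simp
  rw [hn, div_ofReal_im]
  exact div_pos hpos (normSq_pos.2 h0)

/-- Theta functions of level at least three, as products of three factors of level one. -/
theorem exists_thetaLaw_product {α₁ β₁ α₂ β₂ c : ℂ} (hpos : 0 < (α₁ * conj α₂).im) {m : ℕ}
    (hc : c * (α₁ * conj α₂ - α₂ * conj α₁) = (m + 3 : ℕ) * (2 * Real.pi * I)) :
    ∃ K l s : ℂ, ∀ a v : ℂ, ∀ f : ℂ → ℂ,
      (f = fun z => exp (K * z ^ 2 + l * z) *
        (thetaProduct (conj α₂ / conj α₁) ((z + a) / conj α₁) *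
        thetaProduct (conj α₂ / conj α₁) ((z + v) / conj α₁) ^ (m + 1) *
        thetaProduct (conj α₂ / conj α₁) ((z + (s - a - (m + 1) * v)) / conj α₁))) →
      ThetaLaw c f α₁ β₁ ∧ ThetaLaw c f α₂ β₂ := by
  have hα₁ : conj α₁ ≠ 0 := by
    intro h
    rw [map_eq_zero] at h
    simp [h] at hpos
  have hpi : (Real.pi : ℂ) ≠ 0 := by exact_mod_cast Real.pi_ne_zero
  have hτ := im_conj_div_conj_pos hpos
  -- The theta factors are invariant under `conj α₁`, so the law for `α₁` determines `K` and `l`.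
  -- The law for `α₂` involves the shifts only through their sum, and its constant term determines
  -- that sum `s`.
  obtain ⟨K, hK⟩ : ∃ K, 2 * K * conj α₁ = c * α₁ := ⟨c * α₁ / (2 * conj α₁), by field_simp⟩
  obtain ⟨l, hl⟩ : ∃ l, K * conj α₁ ^ 2 + l * conj α₁ = c * β₁ :=
    ⟨(c * β₁ - K * conj α₁ ^ 2) / conj α₁, by field_simp; ring⟩
  obtain ⟨s, hs⟩ : ∃ s, K * conj α₂ ^ 2 + l * conj α₂ + (m + 3) * (Real.pi * I) -
      2 * Real.pi * I * (s / conj α₁) = c * β₂ :=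
    ⟨(K * conj α₂ ^ 2 + l * conj α₂ + (m + 3) * (Real.pi * I) - c * β₂) * conj α₁ /
      (2 * Real.pi * I), by field_simp; ring⟩
  -- The linear term of the law for `α₂` leaves no freedom: it holds because the commutator matches
  -- the number `m + 3` of theta factors.
  have hlin : 2 * K * conj α₂ - (m + 3) * (2 * Real.pi * I) / conj α₁ = c * α₂ := by
    push_cast at hc
    field_simp
    linear_combination conj α₂ * hK + hc
  refine ⟨K, l, s, fun a v f hf => ⟨fun z => ?_, fun z => ?_⟩⟩
  · have h : ∀ x, thetaProduct (conj α₂ / conj α₁) ((z + conj α₁ + x) / conj α₁) =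
        thetaProduct (conj α₂ / conj α₁) ((z + x) / conj α₁) := fun x => by
      rw [← thetaProduct_add_one _ ((z + x) / conj α₁)]
      congr 1
      field_simp
      ring
    simp only [hf, h]
    rw [mul_right_comm (exp (K * z ^ 2 + l * z)), ← exp_add]
    congr 2
    linear_combination z * hK + hl
  · have h : ∀ x, thetaProduct (conj α₂ / conj α₁) ((z + conj α₂ + x) / conj α₁) =
        exp (Real.pi * I - 2 * Real.pi * I * ((z + x) / conj α₁)) *
        thetaProduct (conj α₂ / conj α₁) ((z + x) / conj α₁) := fun x => by
      rw [sub_eq_add_neg, exp_add, exp_pi_mul_I, neg_one_mul, ← thetaProduct_add_tau hτ]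
      congr 1
      field_simp
      ring
    simp only [hf, h, mul_pow, ← exp_nat_mul]
    have hexp : ∀ e a v s t θ₁ θ₂ θ₃ x : ℂ, e + (a + v + s) = t + x →
        exp e * (exp a * θ₁ * (exp v * θ₂) * (exp s * θ₃)) =
          exp t * (θ₁ * θ₂ * θ₃) * exp x := by
      intro e a v s t θ₁ θ₂ θ₃ x h
      have h2 := congrArg exp h
      simp only [exp_add] at h2
      linear_combination θ₁ * θ₂ * θ₃ * h2
    refine hexp _ _ _ _ _ _ _ _ _ ?_
    push_cast
    linear_combination z * hlin + hs

/-- Theta functions of level at least three and trivial character separate the points of the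
elliptic curve. -/
theorem exists_isTheta_separating {Γ : Subgroup (GL (Fin 3) ℂ)} {R : AddSubgroup ℂ}
    [DiscreteTopology R] (hspan : Submodule.span ℝ (R : Set ℂ) = ⊤)
    (hR : ∀ α : ℂ, α ∈ R ↔ ∃ β : ℂ, IsUnipotentIn Γ α β)
    {β₀ : ℂ} (hβ₀ : IsLeastCentral Γ β₀) {r : ℕ} (hr : 3 ≤ r) {z₁ z₂ : ℂ}
    (hz : ∀ α ∈ R, z₁ ≠ z₂ + conj α) :
    ∃ f, IsTheta Γ R β₀ r 1 f ∧ f z₁ ≠ 0 ∧ f z₂ = 0 := by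
  obtain ⟨α₁, hα₁, α₂, hα₂, hpos, hrep⟩ := exists_lattice_basis R hspan
  obtain ⟨β₁, h₁⟩ := (hR α₁).1 hα₁
  obtain ⟨β₂, h₂⟩ := (hR α₂).1 hα₂
  obtain ⟨d, hd, hcomm⟩ := hβ₀.exists_commutator h₁ h₂ hpos
  -- The factors number `r d ≥ 3`: one to vanish at `z₂`, `m + 1` with a free shift `v`, and one to
  -- correct the sum of the shifts.
  obtain ⟨m, hm⟩ : ∃ m, r * d = m + 3 := ⟨r * d - 3, by have := Nat.le_mul_of_pos_right r hd; omega⟩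
  have hc : 2 * Real.pi * I * r / β₀ * β₀ = r * (2 * Real.pi * I) := by
    rw [div_mul_cancel₀ _ hβ₀.ne_zero]
    ring
  have hc' : 2 * Real.pi * I * r / β₀ * (α₁ * conj α₂ - α₂ * conj α₁) =
      (m + 3 : ℕ) * (2 * Real.pi * I) := by
    rw [hcomm, ← hm]
    push_cast
    linear_combination d * hc
  obtain ⟨K, l, s, hlaw⟩ := exists_thetaLaw_product (β₁ := β₁) (β₂ := β₂) hpos hc'
  have hα₁0 : conj α₁ ≠ 0 := by
    intro h
    rw [map_eq_zero] at h
    simp [h] at hpos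
  have hτ : 0 < (conj α₂ / conj α₁).im := im_conj_div_conj_pos hpos
  have hzero : ∀ z, thetaProduct (conj α₂ / conj α₁) (z / conj α₁) = 0 → ∃ α ∈ R, z = conj α := by
    intro z h0
    obtain ⟨k, n, h⟩ := exists_of_thetaProduct_eq_zero hτ h0
    refine ⟨k * α₁ + n * α₂, R.add_mem ?_ ?_, ?_⟩
    · simpa using R.zsmul_mem hα₁ k
    · simpa using R.zsmul_mem hα₂ n
    · field_simp at h
      simp [h, mul_comm]
  have hcount : (R : Set ℂ).Countable := by
    have : Countable R := countable_of_Lindelof_of_discrete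
    exact this
  -- Only countably many `v` make the second or the third factor vanish at `z₁`.
  obtain ⟨v, hv⟩ : ∃ v : ℂ, v ∉ ((fun α => conj α - z₁) '' (R : Set ℂ)) ∪
      ((fun α => (z₁ + s + z₂ - conj α) / (m + 1)) '' (R : Set ℂ)) :=
    (((hcount.image _).union (hcount.image _)).dense_compl ℝ).nonempty
  have hm0 : (m : ℂ) + 1 ≠ 0 := by exact_mod_cast Nat.succ_ne_zero m
  obtain ⟨l₁, l₂⟩ := hlaw (-z₂) v _ rfl
  refine ⟨fun z => exp (K * z ^ 2 + l * z) *
      (thetaProduct (conj α₂ / conj α₁) ((z + -z₂) / conj α₁) *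
      thetaProduct (conj α₂ / conj α₁) ((z + v) / conj α₁) ^ (m + 1) *
      thetaProduct (conj α₂ / conj α₁) ((z + (s - -z₂ - (m + 1) * v)) / conj α₁)),
    ⟨?_, fun α β h z => ?_⟩, ?_, ?_⟩
  · have := differentiable_thetaProduct hτ
    fun_prop
  · rw [AddChar.one_apply, Circle.coe_one, one_mul]
    exact thetaLaw_of_generators hβ₀ hc h₁ h₂ l₁ l₂ h (hrep α α.2) z
  · refine mul_ne_zero (exp_ne_zero _) (mul_ne_zero (mul_ne_zero ?_ (pow_ne_zero _ ?_)) ?_)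
    · intro h0
      obtain ⟨α, hα, h⟩ := hzero _ h0
      exact hz α hα (by linear_combination h)
    · intro h0
      obtain ⟨α, hα, h⟩ := hzero _ h0
      exact hv (Or.inl ⟨α, hα, by linear_combination -h⟩)
    · intro h0
      obtain ⟨α, hα, h⟩ := hzero _ h0
      refine hv (Or.inr ⟨α, hα, ?_⟩)
      change (z₁ + s + z₂ - conj α) / (m + 1) = v
      rw [div_eq_iff hm0]
      linear_combination h
  · simp [thetaProduct_zero hτ]

theorem exists_isTheta_ne_zero {Γ : Subgroup (GL (Fin 3) ℂ)} {R : AddSubgroup ℂ}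
    [DiscreteTopology R] (hspan : Submodule.span ℝ (R : Set ℂ) = ⊤)
    (hR : ∀ α : ℂ, α ∈ R ↔ ∃ β : ℂ, IsUnipotentIn Γ α β)
    {β₀ : ℂ} (hβ₀ : IsLeastCentral Γ β₀) {r : ℕ} (hr : 3 ≤ r) (z : ℂ) :
    ∃ f, IsTheta Γ R β₀ r 1 f ∧ f z ≠ 0 := by
  have hcount : (R : Set ℂ).Countable := by
    have : Countable R := countable_of_Lindelof_of_discrete
    exact this
  obtain ⟨w, hw⟩ : ∃ w : ℂ, w ∉ (fun α => z - conj α) '' (R : Set ℂ) :=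
    ((hcount.image _).dense_compl ℝ).nonempty
  obtain ⟨f, hf, hfz, -⟩ := exists_isTheta_separating hspan hR hβ₀ hr (z₁ := z) (z₂ := w)
    fun α hα h => hw ⟨α, hα, by change z - conj α = w; rw [h]; ring⟩
  exact ⟨f, hf, hfz⟩

/-! ### Conjugation, translation and products of theta functions -/

/-- `β₀` is purely imaginary. That this constant is real is what makes conjugation exchange the two
kinds of theta functions, translation characters unitary, and the growth estimate meaningful. -/
theorem IsLeastCentral.two_pi_I_mul_div {Γ : Subgroup (GL (Fin 3) ℂ)} {β₀ : ℂ}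
    (hβ₀ : IsLeastCentral Γ β₀) (r : ℕ) :
    2 * Real.pi * I * r / β₀ = ((2 * Real.pi * r / β₀.im : ℝ) : ℂ) := by
  have h : β₀ = β₀.im * I := by
    have h := congrArg Complex.re hβ₀.conj_eq
    simp at h
    refine Complex.ext ?_ ?_
    · simp; linarith
    · simp
  have hne : (β₀.im : ℂ) ≠ 0 := by exact_mod_cast hβ₀.2.1.ne'
  rw [h]
  simp only [mul_im, ofReal_re, I_im, mul_one, ofReal_im, I_re, mul_zero, add_zero]
  push_cast
  field_simp

/-- Conjugation exchanges the theta functions on the two conjugate curves. -/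
theorem IsTheta.conj_neg_conj {Γ : Subgroup (GL (Fin 3) ℂ)} {R : AddSubgroup ℂ} {β₀ : ℂ}
    (hβ₀ : IsLeastCentral Γ β₀) {r : ℕ} {ψ : AddChar R Circle} {f : ℂ → ℂ}
    (hf : IsTheta Γ R β₀ r ψ f) : IsConjTheta Γ R β₀ r ψ⁻¹ (fun z => conj (f (-conj z))) := by
  refine ⟨fun z => ?_, fun α β h z => ?_⟩
  · have h := (hf.1.comp (differentiable_id.neg)) (conj z)
    simpa [Function.comp_def] using h.star_star
  · have h1 := hf.2 α β h (-conj z)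
    simp only [map_sub]
    rw [show -(conj z - conj (α : ℂ)) = -conj z + conj (α : ℂ) by ring, h1,
      hβ₀.two_pi_I_mul_div, AddChar.inv_apply', Circle.coe_inv_eq_conj]
    simp only [map_mul, map_add, map_neg, ← exp_conj, conj_conj, conj_ofReal]
    ring_nf

/-- The unitary character of `R` defined by a complex number. -/
def twistChar (R : AddSubgroup ℂ) (t : ℝ) (u : ℂ) : AddChar R Circle where
  toFun α := Circle.exp (t * ((α : ℂ) * u).im)
  map_zero_eq_one' := by simp
  map_add_eq_mul' α α' := by
    rw [← Circle.exp_add]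
    congr 1
    simp
    ring

/-- Translating a theta function changes its character. -/
theorem IsTheta.translate {Γ : Subgroup (GL (Fin 3) ℂ)} {R : AddSubgroup ℂ} {β₀ : ℂ}
    (hβ₀ : IsLeastCentral Γ β₀) {r : ℕ} {f : ℂ → ℂ} (hf : IsTheta Γ R β₀ r 1 f) (u : ℂ) :
    IsTheta Γ R β₀ r (twistChar R (2 * (2 * Real.pi * r / β₀.im)) u)
      (fun z => f (z + u) * exp (-(2 * Real.pi * I * r / β₀ * (conj u * z)))) := by
  refine ⟨?_, fun α β h z => ?_⟩
  · have := hf.1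
    fun_prop
  · have h1 := hf.2 α β h (z + u)
    -- The translation contributes `α u` to the exponent and the exponential factor `-conj (α u)`.
    -- Their sum is `2i Im(α u)`, whence the 2 in the parameter of the character.
    have h2 : ((twistChar R (2 * (2 * Real.pi * r / β₀.im)) u α : Circle) : ℂ) =
        exp (2 * Real.pi * I * r / β₀ * (α * u - conj (α : ℂ) * conj u)) := by
      rw [twistChar, AddChar.coe_mk, Circle.coe_exp, hβ₀.two_pi_I_mul_div]
      congr 1
      have h3 : (α : ℂ) * u - conj (α : ℂ) * conj u = ((2 * ((α : ℂ) * u).im : ℝ) : ℂ) * I := by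
        rw [← map_mul]
        exact sub_conj _
      rw [h3]
      push_cast
      ring
    simp only
    rw [add_right_comm, h1, h2, AddChar.one_apply, Circle.coe_one, one_mul]
    have hexp : ∀ (x a b c d e : ℂ), a + b = c + d + e →
        x * exp a * exp b = exp c * (x * exp d) * exp e := by
      intro x a b c d e h
      have h2 := congrArg exp h
      simp only [exp_add] at h2
      linear_combination x * h2
    refine hexp _ _ _ _ _ _ ?_
    ring

/-- Expanding `(z + conj α)(z' - α)` cancels the terms in `z` and `z'` of the two theta factors and
leaves `β + conj β - α conj α`, which is zero. -/
theorem theta_mul_conjTheta_invariant {Γ : Subgroup (GL (Fin 3) ℂ)} {R : AddSubgroup ℂ}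
    (hR : ∀ α : ℂ, α ∈ R ↔ ∃ β : ℂ, IsUnipotentIn Γ α β)
    {β₀ : ℂ} {r : ℕ} {ψ : AddChar R Circle} {f f' : ℂ → ℂ}
    (hf : IsTheta Γ R β₀ r ψ f) (hf' : IsConjTheta Γ R β₀ r ψ⁻¹ f') {α : ℂ} (hα : α ∈ R)
    (z z' : ℂ) :
    f (z + conj α) * f' (z' - α) *
        exp (2 * Real.pi * I * r / β₀ * ((z + conj α) * (z' - α))) =
      f z * f' z' * exp (2 * Real.pi * I * r / β₀ * (z * z')) := by
  obtain ⟨β, h⟩ := (hR α).1 hα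
  rw [hf.2 ⟨α, hα⟩ β h z, hf'.2 ⟨α, hα⟩ β h z', AddChar.inv_apply']
  have hψ : ((ψ ⟨α, hα⟩ : Circle) : ℂ) * (((ψ ⟨α, hα⟩)⁻¹ : Circle) : ℂ) = 1 := by
    rw [← Circle.coe_mul, mul_inv_cancel, Circle.coe_one]
  have hexp : ∀ (p q x y a b c d : ℂ), p * q = 1 → a + b + c = d →
      p * x * exp a * (q * y * exp b) * exp c = x * y * exp d := by
    intro p q x y a b c d hpq h
    rw [← h]
    simp only [exp_add]
    linear_combination x * y * exp a * exp b * exp c * hpq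
  refine hexp _ _ _ _ _ _ _ _ hψ ?_
  linear_combination (2 * Real.pi * I * r / β₀) * h.1

theorem exists_mdifferentiable_isThetaProduct {Γ : Subgroup (GL (Fin 3) ℂ)} {R : AddSubgroup ℂ}
    [DiscreteTopology R] (hR : ∀ α : ℂ, α ∈ R ↔ ∃ β : ℂ, IsUnipotentIn Γ α β)
    {β₀ : ℂ} {r : ℕ} {ψ : AddChar R Circle} {f f' : ℂ → ℂ}
    (hf : IsTheta Γ R β₀ r ψ f) (hf' : IsConjTheta Γ R β₀ r ψ⁻¹ f') :
    ∃ G : QuotW R → ℂ, MDifferentiable 𝓘(ℂ, ℂ × ℂ) 𝓘(ℂ, ℂ) G ∧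
      ∀ z z' : ℂ, G (QuotW.mk R z z') =
        f z * f' z' * exp (2 * Real.pi * I * r / β₀ * (z * z')) := by
  have h1 := hf.1
  have h2 := hf'.1
  exact QuotW.exists_mdifferentiable
    (F := fun p => f p.1 * f' p.2 * exp (2 * Real.pi * I * r / β₀ * (p.1 * p.2)))
    (by fun_prop) fun α hα z z' => theta_mul_conjTheta_invariant hR hf hf' hα z z'

/-! ### Growth along sequences without cluster point -/

/-- Every complex number is at bounded distance from a lattice. -/
theorem exists_bounded_representatives (R : AddSubgroup ℂ) [DiscreteTopology R]
    (hspan : Submodule.span ℝ (R : Set ℂ) = ⊤) : ∃ M : ℝ, ∀ x : ℂ, ∃ α ∈ R, ‖x - α‖ ≤ M := by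
  obtain ⟨α₁, h₁, α₂, h₂, him, -⟩ := exists_lattice_basis R hspan
  obtain ⟨δ, hδ⟩ : ∃ δ, δ = (α₁ * conj α₂).im := ⟨_, rfl⟩
  have hδ0 : δ ≠ 0 := hδ ▸ him.ne'
  refine ⟨‖α₁‖ + ‖α₂‖, fun x => ?_⟩
  obtain ⟨s, hs⟩ : ∃ s, s = (x * conj α₂).im / δ := ⟨_, rfl⟩
  obtain ⟨t, ht⟩ : ∃ t, t = -(x * conj α₁).im / δ := ⟨_, rfl⟩
  have hx : x = s * α₁ + t * α₂ := by
    rw [eq_div_iff hδ0] at hs ht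
    rw [hδ] at hs ht hδ0
    simp only [mul_im, conj_re, conj_im] at hs ht hδ0
    refine Complex.ext (mul_left_cancel₀ hδ0 ?_) (mul_left_cancel₀ hδ0 ?_)
    · rw [add_re, re_ofReal_mul, re_ofReal_mul]
      linear_combination -α₁.re * hs - α₂.re * ht
    · rw [add_im, im_ofReal_mul, im_ofReal_mul]
      linear_combination -α₁.im * hs - α₂.im * ht
  refine ⟨⌊s⌋ * α₁ + ⌊t⌋ * α₂, R.add_mem ?_ ?_, ?_⟩
  · simpa using R.zsmul_mem h₁ ⌊s⌋
  · simpa using R.zsmul_mem h₂ ⌊t⌋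
  · have h : x - (⌊s⌋ * α₁ + ⌊t⌋ * α₂) = (Int.fract s : ℝ) * α₁ + (Int.fract t : ℝ) * α₂ := by
      rw [Int.fract, Int.fract]
      push_cast
      linear_combination hx
    rw [h]
    refine (norm_add_le _ _).trans ?_
    rw [norm_mul, norm_mul, norm_real, norm_real, Real.norm_of_nonneg (Int.fract_nonneg s),
      Real.norm_of_nonneg (Int.fract_nonneg t)]
    gcongr
    · exact mul_le_of_le_one_left (norm_nonneg _) (Int.fract_lt_one s).le
    · exact mul_le_of_le_one_left (norm_nonneg _) (Int.fract_lt_one t).le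

/-- The action moves both coordinates at once, so it can only make `z` bounded; what remains of `z'`
modulo `R` is the translation `γ`, which measures the distance to infinity in 𝐖. -/
theorem QuotW.exists_bounded_representatives (R : AddSubgroup ℂ) [DiscreteTopology R]
    (hspan : Submodule.span ℝ (R : Set ℂ) = ⊤) :
    ∃ M : ℝ, ∀ w : QuotW R, ∃ x y : ℂ, ∃ γ : R, ‖x‖ ≤ M ∧ ‖y‖ ≤ M ∧ QuotW.mk R x (y - γ) = w := by
  obtain ⟨M, hM⟩ := _root_.exists_bounded_representatives R hspan
  refine ⟨M, fun w => ?_⟩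
  obtain ⟨z, z', rfl⟩ := QuotW.mk_surjective w
  obtain ⟨α, hα, h⟩ := hM (conj z)
  obtain ⟨η, hη, h'⟩ := hM (z' + α)
  refine ⟨z - conj α, z' + α - η, ⟨-η, R.neg_mem hη⟩, ?_, h', ?_⟩
  · rwa [← norm_conj, map_sub, conj_conj]
  · exact QuotW.mk_eq_mk.2 ⟨-α, R.neg_mem hα, by rw [map_neg]; ring, by ring⟩

/-- `Re (conj β) = ‖γ‖²/2` dominates the other terms, which are at most linear in `‖γ‖`. The
constant comes from `(‖γ‖ - (2M + 1))² ≥ 0`. -/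
theorem re_exponent_ge {x y γ β : ℂ} {M : ℝ} (hM : 0 ≤ M) (hx : ‖x‖ ≤ M) (hy : ‖y‖ ≤ M)
    (hβ : β + conj β = γ * conj γ) :
    ‖γ‖ - ((2 * M + 1) ^ 2 / 2 + M ^ 2) ≤ (-conj γ * y + conj β + x * (y - γ)).re := by
  have hre : (conj β).re = ‖γ‖ ^ 2 / 2 := by
    rw [mul_conj, normSq_eq_norm_sq] at hβ
    have := congrArg Complex.re hβ
    simp only [add_re, conj_re, ofReal_re] at this
    rw [conj_re]
    linarith
  have h1 : -(‖γ‖ * M) ≤ (-conj γ * y).re := by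
    refine (neg_le_neg ?_).trans (neg_le_of_abs_le (abs_re_le_norm _))
    rw [norm_mul, norm_neg, norm_conj]
    gcongr
  have h2 : -(M * (M + ‖γ‖)) ≤ (x * (y - γ)).re := by
    refine (neg_le_neg ?_).trans (neg_le_of_abs_le (abs_re_le_norm _))
    rw [norm_mul]
    gcongr
    exact (norm_sub_le _ _).trans (by gcongr)
  rw [add_re, add_re, hre]
  nlinarith [sq_nonneg (‖γ‖ - (2 * M + 1))]

theorem exists_isConjTheta_ne_zero {Γ : Subgroup (GL (Fin 3) ℂ)} {R : AddSubgroup ℂ}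
    [DiscreteTopology R] (hspan : Submodule.span ℝ (R : Set ℂ) = ⊤)
    (hR : ∀ α : ℂ, α ∈ R ↔ ∃ β : ℂ, IsUnipotentIn Γ α β)
    {β₀ : ℂ} (hβ₀ : IsLeastCentral Γ β₀) {r : ℕ} (hr : 3 ≤ r) (z : ℂ) :
    ∃ f, IsConjTheta Γ R β₀ r 1⁻¹ f ∧ f z ≠ 0 := by
  obtain ⟨f, hf, hfz⟩ := exists_isTheta_ne_zero hspan hR hβ₀ hr (-conj z)
  exact ⟨_, hf.conj_neg_conj hβ₀, by simpa using hfz⟩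

theorem exists_isThetaProduct_unbounded {Γ : Subgroup (GL (Fin 3) ℂ)} {R : AddSubgroup ℂ}
    [DiscreteTopology R] (hspan : Submodule.span ℝ (R : Set ℂ) = ⊤)
    (hR : ∀ α : ℂ, α ∈ R ↔ ∃ β : ℂ, IsUnipotentIn Γ α β)
    {β₀ : ℂ} (hβ₀ : IsLeastCentral Γ β₀) {r : ℕ} (hr : 3 ≤ r) (w : ℕ → QuotW R)
    (hw : ∀ x : QuotW R, ¬ MapClusterPt x atTop w) :
    ∃ G : QuotW R → ℂ, IsThetaProduct Γ R β₀ r 1 G ∧ ∀ C : ℝ, ∃ n : ℕ, C < ‖G (w n)‖ := by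
  obtain ⟨M, hM⟩ := QuotW.exists_bounded_representatives R hspan
  choose x y γ hx hy hxy using fun n => hM (w n)
  have hM0 : 0 ≤ M := (norm_nonneg _).trans (hx 0)
  -- Along an ultrafilter all bounded sequences converge at once, which replaces repeated passage to
  -- subsequences.
  obtain ⟨U, hU⟩ : ∃ U : Ultrafilter ℕ, (U : Filter ℕ) ≤ atTop := Ultrafilter.exists_le atTop
  have hlim : ∀ (a : ℕ → ℂ) (B : ℝ), (∀ᶠ n in (U : Filter ℕ), ‖a n‖ ≤ B) →
      ∃ e, Tendsto a U (𝓝 e) := by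
    intro a B h
    obtain ⟨e, -, he⟩ := (isCompact_closedBall (0 : ℂ) B).ultrafilter_le_nhds (U.map a) (by
      rw [le_principal_iff]
      change ∀ᶠ n in (U : Filter ℕ), a n ∈ Metric.closedBall 0 B
      filter_upwards [h] with n hn
      simpa using hn)
    exact ⟨e, he⟩
  obtain ⟨e, he⟩ := hlim x M (.of_forall hx)
  obtain ⟨e', he'⟩ := hlim y M (.of_forall hy)
  -- Otherwise `γ` would also converge along `U`, and the limits would give a cluster point of `w`.
  have hγ : Tendsto (fun n => ‖(γ n : ℂ)‖) U atTop := by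
    refine tendsto_atTop.2 fun B => ?_
    by_contra hcon
    rw [← Ultrafilter.eventually_not] at hcon
    obtain ⟨g, hg⟩ := hlim (fun n => γ n) B (hcon.mono fun n hn => (not_le.1 hn).le)
    refine hw (QuotW.mk R e (e' - g)) (mapClusterPt_iff_ultrafilter.2 ⟨U, hU, ?_⟩)
    have := ((QuotW.continuous_mk R).tendsto (e, e' - g)).comp (he.prodMk_nhds (he'.sub hg))
    refine this.congr fun n => ?_
    exact hxy n
  -- Nonvanishing at the limits `e`, `e'` keeps `|f (x n)| |f' (y n)|` away from zero along `U`, so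
  -- the exponential factor decides.
  obtain ⟨f, hf, hfe⟩ := exists_isTheta_ne_zero hspan hR hβ₀ hr e
  obtain ⟨f', hf', hfe'⟩ := exists_isConjTheta_ne_zero hspan hR hβ₀ hr e'
  obtain ⟨G, -, hG⟩ := exists_mdifferentiable_isThetaProduct hR hf hf'
  refine ⟨G, ⟨f, f', hf, hf', hG⟩, fun C => ?_⟩
  obtain ⟨κ, hκ⟩ : ∃ κ, κ = 2 * Real.pi * r / β₀.im := ⟨_, rfl⟩
  have hκ0 : 0 < κ := by
    rw [hκ]
    have := hβ₀.2.1
    have hr0 : (0 : ℝ) < r := by exact_mod_cast (by omega : 0 < r)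
    positivity
  obtain ⟨B, hB⟩ : ∃ B, B = (2 * M + 1) ^ 2 / 2 + M ^ 2 := ⟨_, rfl⟩
  have hnorm : ∀ n, ‖f (x n)‖ * ‖f' (y n)‖ * Real.exp (κ * (‖(γ n : ℂ)‖ - B)) ≤ ‖G (w n)‖ := by
    intro n
    obtain ⟨β, hβ⟩ := (hR (γ n)).1 (γ n).2
    rw [← hxy n, hG, hf'.2 (γ n) β hβ, inv_one, AddChar.one_apply, Circle.coe_one, one_mul,
      ← mul_assoc, mul_assoc (f (x n) * f' (y n)), ← exp_add, norm_mul, norm_mul, Complex.norm_exp,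
      hβ₀.two_pi_I_mul_div, ← hκ, ← mul_add, re_ofReal_mul]
    gcongr
    rw [hB]
    exact re_exponent_ge hM0 (hx n) (hy n) hβ.1
  have hT : Tendsto (fun n => ‖f (x n)‖ * ‖f' (y n)‖ * Real.exp (κ * (‖(γ n : ℂ)‖ - B))) U
      atTop := by
    refine Tendsto.pos_mul_atTop (C := ‖f e‖ * ‖f' e'‖)
      (mul_pos (norm_pos_iff.2 hfe) (norm_pos_iff.2 hfe')) ?_ ?_
    · exact (((hf.1.continuous.tendsto e).comp he).norm).mul
        (((hf'.1.continuous.tendsto e').comp he').norm)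
    · exact Real.tendsto_exp_atTop.comp
        ((tendsto_atTop_add_const_right _ (-B) hγ).const_mul_atTop hκ0)
  obtain ⟨n, hn⟩ := ((tendsto_atTop_mono hnorm hT).eventually_gt_atTop C).exists
  exact ⟨n, hn⟩

/-! ### Separation of points -/

/-- One theta factor is made to vanish at the second point but not at the first, and the other is
nonzero at the first. On the second curve `z' ↦ -conj z'` reduces this to the first. -/
theorem exists_isThetaProduct_one_ne {Γ : Subgroup (GL (Fin 3) ℂ)} {R : AddSubgroup ℂ}
    [DiscreteTopology R] (hspan : Submodule.span ℝ (R : Set ℂ) = ⊤)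
    (hR : ∀ α : ℂ, α ∈ R ↔ ∃ β : ℂ, IsUnipotentIn Γ α β)
    {β₀ : ℂ} (hβ₀ : IsLeastCentral Γ β₀) {r : ℕ} (hr : 3 ≤ r) {z₁ z₁' z₂ z₂' : ℂ}
    (h : (∀ α ∈ R, z₁ ≠ z₂ + conj α) ∨ (∀ α ∈ R, z₁' ≠ z₂' - α)) :
    ∃ G : QuotW R → ℂ, IsThetaProduct Γ R β₀ r 1 G ∧
      G (QuotW.mk R z₁ z₁') ≠ G (QuotW.mk R z₂ z₂') := by
  rcases h with h | h
  · obtain ⟨f, hf, hf₁, hf₂⟩ := exists_isTheta_separating hspan hR hβ₀ hr h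
    obtain ⟨f', hf', hf₁'⟩ := exists_isConjTheta_ne_zero hspan hR hβ₀ hr z₁'
    obtain ⟨G, -, hG⟩ := exists_mdifferentiable_isThetaProduct hR hf hf'
    refine ⟨G, ⟨f, f', hf, hf', hG⟩, ?_⟩
    rw [hG, hG, hf₂, zero_mul, zero_mul]
    exact mul_ne_zero (mul_ne_zero hf₁ hf₁') (exp_ne_zero _)
  · obtain ⟨f, hf, hf₁⟩ := exists_isTheta_ne_zero hspan hR hβ₀ hr z₁
    obtain ⟨k, hk, hk₁, hk₂⟩ := exists_isTheta_separating hspan hR hβ₀ hr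
      (z₁ := -conj z₁') (z₂ := -conj z₂') (fun α hα h0 => h α hα (by
        have := congrArg conj h0
        simp only [map_neg, map_add, conj_conj] at this
        linear_combination -this))
    obtain ⟨G, -, hG⟩ := exists_mdifferentiable_isThetaProduct hR hf (hk.conj_neg_conj hβ₀)
    refine ⟨G, ⟨f, _, hf, hk.conj_neg_conj hβ₀, hG⟩, ?_⟩
    rw [hG, hG, hk₂, map_zero, mul_zero, zero_mul]
    refine mul_ne_zero (mul_ne_zero hf₁ ?_) (exp_ne_zero _)
    simpa using hk₁

/-- The translation is chosen so that `t δ u = π i`. -/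
theorem twistChar_eq_neg_one {R : AddSubgroup ℂ} {t : ℝ} (ht : t ≠ 0) {δ : R}
    (hδ : (δ : ℂ) ≠ 0) : twistChar R t (Real.pi / (t * δ) * I) δ = Circle.exp Real.pi := by
  rw [twistChar, AddChar.coe_mk]
  congr 1
  have ht' : (t : ℂ) ≠ 0 := by exact_mod_cast ht
  have h : (δ : ℂ) * (Real.pi / (t * δ) * I) = ((Real.pi / t : ℝ) : ℂ) * I := by
    push_cast
    field_simp
  rw [h, mul_I_im, ofReal_re]
  field_simp

theorem exists_isThetaProduct_ne {Γ : Subgroup (GL (Fin 3) ℂ)} {R : AddSubgroup ℂ}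
    [DiscreteTopology R] (hspan : Submodule.span ℝ (R : Set ℂ) = ⊤)
    (hR : ∀ α : ℂ, α ∈ R ↔ ∃ β : ℂ, IsUnipotentIn Γ α β)
    {β₀ : ℂ} (hβ₀ : IsLeastCentral Γ β₀) {r : ℕ} (hr : 3 ≤ r) {p q : QuotW R} (hpq : p ≠ q) :
    ∃ (ψ : AddChar R Circle) (G : QuotW R → ℂ), IsThetaProduct Γ R β₀ r ψ G ∧ G p ≠ G q := by
  obtain ⟨z, z₁', rfl⟩ := QuotW.mk_surjective p
  obtain ⟨z₂, z₂', rfl⟩ := QuotW.mk_surjective q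
  -- If both images agree, the second point can be moved to the same first coordinate; the second
  -- coordinates then differ by some `δ ∈ R`, nonzero because the points are distinct.
  by_cases h : (∀ α ∈ R, z ≠ z₂ + conj α) ∨ (∀ α ∈ R, z₁' ≠ z₂' - α)
  · exact ⟨1, exists_isThetaProduct_one_ne hspan hR hβ₀ hr h⟩
  push Not at h
  obtain ⟨⟨α, hα, h₁⟩, α', hα', h₂⟩ := h
  obtain ⟨δ, hδ⟩ : ∃ δ : R, (δ : ℂ) = α' - α := ⟨⟨α' - α, R.sub_mem hα' hα⟩, rfl⟩
  obtain ⟨z', hz'⟩ : ∃ z', z' = z₂' - α := ⟨_, rfl⟩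
  have hq : QuotW.mk R z₂ z₂' = QuotW.mk R z z' := by
    refine (QuotW.mk_eq_mk.2 ⟨α, hα, h₁, hz'⟩).symm
  have hp : z₁' = z' - δ := by
    rw [h₂, hz', hδ]
    ring
  rw [hq, hp] at hpq
  rw [hq, hp]
  have hδ0 : (δ : ℂ) ≠ 0 := by
    intro h0
    rw [h0, sub_zero] at hpq
    exact hpq rfl
  obtain ⟨β, hβ⟩ := (hR δ).1 δ.2
  -- The quotient of the two values depends on the character only through its value at `δ`.
  obtain ⟨A, hA⟩ : ∃ A : ℂ, A = exp (2 * Real.pi * I * r / β₀ * (-conj (δ : ℂ) * z' + conj β)) *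
    exp (2 * Real.pi * I * r / β₀ * -(z * δ)) := ⟨_, rfl⟩
  have key : ∀ (ψ : AddChar R Circle) (f : ℂ → ℂ), IsTheta Γ R β₀ r ψ f → f z ≠ 0 →
      ∀ f' : ℂ → ℂ, IsConjTheta Γ R β₀ r ψ⁻¹ f' → f' z' ≠ 0 →
      ((ψ⁻¹ δ : Circle) : ℂ) * A ≠ 1 → ∃ (ψ : AddChar R Circle) (G : QuotW R → ℂ),
        IsThetaProduct Γ R β₀ r ψ G ∧ G (QuotW.mk R z (z' - δ)) ≠ G (QuotW.mk R z z') := by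
    intro ψ f hf hfz f' hf' hfz' hne
    obtain ⟨G, -, hG⟩ := exists_mdifferentiable_isThetaProduct hR hf hf'
    refine ⟨ψ, G, ⟨f, f', hf, hf', hG⟩, fun heq => hne ?_⟩
    have hexp : exp (2 * Real.pi * I * r / β₀ * (z * (z' - δ))) =
        exp (2 * Real.pi * I * r / β₀ * (z * z')) * exp (2 * Real.pi * I * r / β₀ * -(z * δ)) := by
      rw [← exp_add]
      ring_nf
    rw [hG, hG, hf'.2 δ β hβ, hexp] at heq
    refine mul_left_cancel₀ (mul_ne_zero (mul_ne_zero hfz hfz')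
      (exp_ne_zero (2 * Real.pi * I * r / β₀ * (z * z')))) ?_
    rw [hA, mul_one]
    linear_combination heq
  -- The ratio of the two values is `ψ⁻¹ δ * A`. If `A ≠ 1` the trivial character works; if `A = 1`,
  -- a translated pair with `ψ δ = -1` gives ratio `-1`.
  by_cases hA1 : A = 1
  · obtain ⟨t, ht⟩ : ∃ t, t = 2 * (2 * Real.pi * r / β₀.im) := ⟨_, rfl⟩
    have ht0 : t ≠ 0 := by
      rw [ht]
      have := hβ₀.2.1
      have hr0 : (0 : ℝ) < r := by exact_mod_cast (by omega : 0 < r)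
      positivity
    obtain ⟨u, hu⟩ : ∃ u : ℂ, u = Real.pi / (t * δ) * I := ⟨_, rfl⟩
    obtain ⟨f, hf, hfz⟩ := exists_isTheta_ne_zero hspan hR hβ₀ hr (z + u)
    obtain ⟨k, hk, hkz⟩ := exists_isTheta_ne_zero hspan hR hβ₀ hr (-conj z' + u)
    have hf' := hf.translate hβ₀ u
    have hk' := (hk.translate hβ₀ u).conj_neg_conj hβ₀
    refine key _ _ hf' (mul_ne_zero hfz (exp_ne_zero _)) _ hk' ?_ ?_
    · rw [ne_eq, map_eq_zero]
      exact mul_ne_zero hkz (exp_ne_zero _)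
    · rw [hA1, mul_one, AddChar.inv_apply', ← ht, hu, twistChar_eq_neg_one ht0 hδ0,
        Circle.coe_inv, Circle.coe_exp, exp_pi_mul_I]
      norm_num
  · obtain ⟨f, hf, hfz⟩ := exists_isTheta_ne_zero hspan hR hβ₀ hr z
    obtain ⟨f', hf', hfz'⟩ := exists_isConjTheta_ne_zero hspan hR hβ₀ hr z'
    refine key 1 f hf hfz f' hf' hfz' ?_
    simpa using hA1

end

theorem proposition2 (Γ : Subgroup (GL (Fin 3) ℂ)) (R : AddSubgroup ℂ) [DiscreteTopology R]
    (hspan : Submodule.span ℝ (R : Set ℂ) = ⊤)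
    (hR : ∀ α : ℂ, α ∈ R ↔ ∃ β : ℂ, IsUnipotentIn Γ α β)
    (β₀ : ℂ) (hβ₀ : IsLeastCentral Γ β₀) :
    -- the quotient is a Stein manifold
    IsSteinManifold (ℂ × ℂ) (QuotW R) ∧
    -- the products of theta functions descend to holomorphic functions on the quotient
    (∀ (r : ℕ) (ψ : AddChar R Circle) (f f' : ℂ → ℂ),
      IsTheta Γ R β₀ r ψ f → IsConjTheta Γ R β₀ r ψ⁻¹ f' →
      ∃ G : QuotW R → ℂ, MDifferentiable 𝓘(ℂ, ℂ × ℂ) 𝓘(ℂ, ℂ) G ∧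
        ∀ z z' : ℂ, G (QuotW.mk R z z') =
          f z * f' z' * exp (2 * Real.pi * I * r / β₀ * (z * z'))) ∧
    ∃ r₀ : ℕ, ∀ r : ℕ, r₀ ≤ r →
      -- with trivial character they separate points with distinct images in one of the two curves
      (∀ z₁ z₁' z₂ z₂' : ℂ,
        ((∀ α ∈ R, z₁ ≠ z₂ + conj α) ∨ (∀ α ∈ R, z₁' ≠ z₂' - α)) →
        ∃ G : QuotW R → ℂ, IsThetaProduct Γ R β₀ r 1 G ∧
          G (QuotW.mk R z₁ z₁') ≠ G (QuotW.mk R z₂ z₂')) ∧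
      -- with arbitrary unitary characters they separate all points
      (∀ p q : QuotW R, p ≠ q →
        ∃ (ψ : AddChar R Circle) (G : QuotW R → ℂ), IsThetaProduct Γ R β₀ r ψ G ∧ G p ≠ G q) ∧
      -- with trivial character one of them is unbounded on a given sequence without cluster point
      (∀ w : ℕ → QuotW R, (∀ x : QuotW R, ¬ MapClusterPt x atTop w) →
        ∃ G : QuotW R → ℂ, IsThetaProduct Γ R β₀ r 1 G ∧ ∀ C : ℝ, ∃ n : ℕ, C < ‖G (w n)‖) := by
  refine ⟨isSteinManifold_quotW R hspan, fun r ψ f f' hf hf' =>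
    exists_mdifferentiable_isThetaProduct hR hf hf', 3, fun r hr => ⟨?_, ?_, ?_⟩⟩
  · exact fun _ _ _ _ h => exists_isThetaProduct_one_ne hspan hR hβ₀ hr h
  · exact fun _ _ h => exists_isThetaProduct_ne hspan hR hβ₀ hr h
  · exact fun w hw => exists_isThetaProduct_unbounded hspan hR hβ₀ hr w hw
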